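/- Let $n=em$ with integers $e\ge 2$, $m\ge 2$, and let $\rho$ be an integer with $1\le\rho<\lfloor n/2\rfloor$. Let $f\in\mathbb Z_4[x]$ be a basic primitive polynomial of degree $n$ (monic, with $f \bmod 2$ primitive over $GF(2)$), let $GR(4,n)=\mathbb Z_4[x]/(f)$ be the Galois ring, and let $x\mapsto\bar x$ be its projection to $GF(2^n)$. Let $G_C$ be the cyclic group of order $2^n-1$ of those units $u$ with $u^{2^n-1}=1$, let $\beta$ be a generator of $G_C$, and put $T=G_C\cup\{0\}$. Every $x\in GR(4,n)$ is uniquely $x=x_0+2x_1$ with $x_0,x_1\in T$. For $d\mid n$ put $\sigma_d(x)=x_0^{2^d}+2x_1^{2^d}$; the subring $GR(4,d)$ is the fixed set of $\sigma_d$. For $k\mid n$ put $Tr_1^{k}(x)=\sum_{i=0}^{k-1}\sigma_1^i(x)$. Fix $\lambda\in GR(4,e)$ with $\bar\lambda\notin\{0,1\}$. With $l=\lfloor m/2\rfloor$ define $$P(x)=\begin{cases}\sum_{j=1}^{l-1}Tr_1^n\big(x^{2^{ej}+1}\big)+Tr_1^{le}\big(x^{2^{le}+1}\big), & m=2l,\\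 \sum_{j=1}^{l}Tr_1^n\big(x^{2^{ej}+1}\big), & m=2l+1.\end{cases}$$ Let $\mathcal L$ be the family consisting of the $\mathbb Z_4$-valued sequences $$s(t)=Tr_1^n\big[(1+2\lambda_0)\beta^t\big]+2\sum_{k=1}^{\rho-1}Tr_1^n\big(\lambda_k\beta^{t(1+2^k)}\big)+2P(\lambda\beta^t),\qquad (\lambda_0,\dots,\lambda_{\rho-1})\in T^\rho,$$ together with the sequence $s(t)=2\,Tr_1^n(\beta^t)$. For sequences $a,b$ of period $L=2^n-1$ and $0\le\tau<L$ let $R_{a,b}(\tau)=\sum_{t=0}^{L-1}\omega^{a(t)-b(t+\tau)}$, where $\omega\in\mathbb C$, $\omega^2=-1$, and let $$R_{\max}=\max\{|R_{a,b}(\tau)| : a,b\in\mathcal L,\ 0\le\tau<L,\ a\ne b\text{ or }\tau\ne0\}.$$ Then $\mathcal L$ consists of exactly $2^{n\rho}+1$ sequences, no two different members of $\mathcal L$ are cyclic shifts of each other, every member has least period $2^n-1$, and $$R_{\max}<1+2^{\frac{n+2(\rho-1)+2e}{2}}.$$ -/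

import Mathlib

open Polynomial

noncomputable section

namespace Quadriphase

/-! ### Quadriphase sequences and correlation -/

/-- The correlation `R_{a,b}(τ) = ∑_{t=0}^{L-1} ω^{a(t)-b(t+τ)}` of two `ℤ/4`-valued sequences of
period `L`.  Here `ω` is a complex number with `ω² = -1`, so only the exponent mod 4 matters. -/
def correlation (ω : ℂ) (L : ℕ) (a b : ℕ → ZMod 4) (τ : ℕ) : ℂ :=
  ∑ t ∈ Finset.range L, ω ^ (a t - b (t + τ)).val

/-- The set of all nontrivial correlation magnitudes `|R_{a,b}(τ)|`, `a, b ∈ F`, `0 ≤ τ < L`,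
where `a ≠ b` or `τ ≠ 0`.  Its greatest element is the maximum correlation magnitude of `F`. -/
def correlationMagnitudes (ω : ℂ) (L : ℕ) (F : Set (ℕ → ZMod 4)) : Set ℝ :=
  {r | ∃ a ∈ F, ∃ b ∈ F, ∃ τ < L, (a ≠ b ∨ τ ≠ 0) ∧ r = ‖correlation ω L a b τ‖}

/-- `L` is the (least) period of the sequence `a`. -/
def HasLeastPeriod (a : ℕ → ZMod 4) (L : ℕ) : Prop :=
  IsLeast {p : ℕ | 0 < p ∧ Function.Periodic a p} L

/-- Distinct members of `F` are never cyclic shifts of one another. -/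
def CyclicallyDistinct (F : Set (ℕ → ZMod 4)) : Prop :=
  ∀ a ∈ F, ∀ b ∈ F, ∀ τ : ℕ, (∀ t, a t = b (t + τ)) → a = b

/-! ### Basic primitive polynomials and the Galois ring -/

/-- Reduction modulo 2 from `ℤ/4` to `ℤ/2`. -/
def red : ZMod 4 →+* ZMod 2 := ZMod.castHom (by norm_num : 2 ∣ 4) (ZMod 2)

/-- `g` is a primitive polynomial of degree `n` over `GF(2)`: it is irreducible of degree `n` and
its root has multiplicative order `2 ^ n - 1`. -/
def IsPrimitivePoly (g : (ZMod 2)[X]) (n : ℕ) : Prop :=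
  Irreducible g ∧ g.natDegree = n ∧ orderOf (AdjoinRoot.root g) = 2 ^ n - 1

/-- `f` is a basic primitive polynomial of degree `n` over `ℤ/4`. -/
def IsBasicPrimitive (f : (ZMod 4)[X]) (n : ℕ) : Prop :=
  f.Monic ∧ f.natDegree = n ∧ IsPrimitivePoly (f.map red) n

/-- The Galois ring `GR(4,n) = (ℤ/4)[x]/(f)`, for `f` basic primitive of degree `n`. -/
abbrev GR (f : (ZMod 4)[X]) : Type := AdjoinRoot f

/-- The residue field `GF(2^n) = (ℤ/2)[x]/(f mod 2)`. -/
abbrev ResField (f : (ZMod 4)[X]) : Type := AdjoinRoot (f.map red)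

/-- The projection `x ↦ x̄` from `GR(4,n)` to `GF(2^n)`. -/
def proj (f : (ZMod 4)[X]) : GR f →+* ResField f :=
  AdjoinRoot.map red f (f.map red) dvd_rfl

/-- The cyclic group `G_C` of units of order `2^n - 1`: all units `u` with `u^(2^n-1) = 1`. -/
def GC (f : (ZMod 4)[X]) (n : ℕ) : Subgroup (GR f)ˣ := rootsOfUnity (2 ^ n - 1) (GR f)

/-- The set `G_C ∪ {0}` (of size `2^n`), the range of the two components of 2-adic
representations. -/
def GC₀ (f : (ZMod 4)[X]) (n : ℕ) : Set (GR f) := {x | x = 0 ∨ ∃ u ∈ GC f n, (u : GR f) = x}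

/-! Existence and uniqueness of the 2-adic representation -/

lemma red_ker (a : ZMod 4) (h : red a = 0) : ∃ b, a = 2 * b := by
  revert a; decide

lemma four_eq_zero (f : (ZMod 4)[X]) : (2 : GR f) * 2 = 0 := by
  have h : (2 : ZMod 4) * 2 = 0 := by decide
  have := congrArg (algebraMap (ZMod 4) (GR f)) h
  rwa [map_mul, map_zero, map_ofNat] at this

lemma poly_two_dvd (p : (ZMod 4)[X]) (h : ∀ i, ∃ b, p.coeff i = 2 * b) : ∃ q, p = 2 * q := by
  choose b hb using h
  refine ⟨∑ i ∈ p.support, monomial i (b i), ?_⟩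
  conv_lhs => rw [p.as_sum_support]
  rw [Finset.mul_sum]
  refine Finset.sum_congr rfl fun i _ => ?_
  rw [hb i, ← map_ofNat C 2, C_mul_monomial]

lemma proj_mk (f p : (ZMod 4)[X]) :
    proj f (AdjoinRoot.mk f p) = AdjoinRoot.mk (f.map red) (p.map red) := by
  simp [proj, AdjoinRoot.map]
  rw [← Polynomial.eval₂_map, ← AdjoinRoot.aeval_eq]
  simp [Polynomial.aeval_def]

lemma proj_ker (f : (ZMod 4)[X]) (x : GR f) (h : proj f x = 0) : ∃ y, x = 2 * y := by
  obtain ⟨p, rfl⟩ := AdjoinRoot.mk_surjective x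
  rw [proj_mk, AdjoinRoot.mk_eq_zero] at h
  obtain ⟨q, hq⟩ := h
  obtain ⟨q, rfl⟩ := Polynomial.map_surjective red (ZMod.castHom_surjective _) q
  obtain ⟨r, hr⟩ := poly_two_dvd (p - f * q) (fun i => red_ker _ (by
    rw [← Polynomial.coeff_map]; simp [hq]))
  refine ⟨AdjoinRoot.mk f r, ?_⟩
  have := congrArg (AdjoinRoot.mk f) hr
  simpa [map_ofNat (AdjoinRoot.mk f) 2] using this

lemma two_mul_eq_zero (f : (ZMod 4)[X]) (hf : f.Monic) (x : GR f) (h : 2 * x = 0) :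
    ∃ y, x = 2 * y := by
  have hker : ∀ a : ZMod 4, 2 * a = 0 → ∃ b, a = 2 * b := by decide
  obtain ⟨p, rfl⟩ := AdjoinRoot.mk_surjective x
  have h1 : AdjoinRoot.mk f (p %ₘ f) = AdjoinRoot.mk f p := by
    conv_rhs => rw [← Polynomial.modByMonic_add_div p f]
    simp
  rw [← h1] at h ⊢
  have h2 : AdjoinRoot.mk f (C 2 * (p %ₘ f)) = 0 := by
    rwa [map_mul, map_ofNat C 2, map_ofNat (AdjoinRoot.mk f) 2]
  rw [AdjoinRoot.mk_eq_zero, ← Polynomial.modByMonic_eq_zero_iff_dvd hf, ← Polynomial.smul_eq_C_mul,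
    Polynomial.smul_modByMonic, Polynomial.modByMonic_eq_of_dvd_sub hf (p₂ := p)] at h2
  · obtain ⟨r, hr⟩ := poly_two_dvd (p %ₘ f) (fun i => hker _ (by
      simpa using congrArg (fun s => Polynomial.coeff s i) h2))
    exact ⟨AdjoinRoot.mk f r, by rw [hr, map_mul, map_ofNat (AdjoinRoot.mk f) 2]⟩
  · rw [Polynomial.modByMonic_eq_sub_mul_div]
    simp

lemma resField_pow (f : (ZMod 4)[X]) (n : ℕ) (hf : IsBasicPrimitive f n) (y : ResField f) :
    y ^ 2 ^ n = y := by
  obtain ⟨-, -, hirr, hdeg, -⟩ := hf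
  have : Fact (Irreducible (f.map red)) := ⟨hirr⟩
  have hne : f.map red ≠ 0 := hirr.ne_zero
  let pb := AdjoinRoot.powerBasis hne
  have : Module.Finite (ZMod 2) (ResField f) := pb.finite
  have : Finite (ResField f) := Module.finite_of_finite (ZMod 2)
  haveI := Fintype.ofFinite (ResField f)
  have hcard : Fintype.card (ResField f) = 2 ^ n := by
    rw [Module.card_eq_pow_finrank (K := ZMod 2), pb.finrank, ZMod.card,
      AdjoinRoot.powerBasis_dim, hdeg]
  rw [← hcard, FiniteField.pow_card]

lemma degree_pos (f : (ZMod 4)[X]) (n : ℕ) (hf : IsBasicPrimitive f n) : 0 < n := by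
  obtain ⟨-, -, hirr, hdeg, -⟩ := hf
  exact hdeg ▸ hirr.natDegree_pos

lemma pow_add_two_mul (f : (ZMod 4)[X]) (n : ℕ) (hn : 0 < n) (x w : GR f) :
    (x + 2 * w) ^ 2 ^ n = x ^ 2 ^ n := by
  obtain ⟨k, rfl⟩ := Nat.exists_eq_succ_of_ne_zero hn.ne'
  rw [pow_succ', pow_mul, pow_mul]
  congr 1
  linear_combination (x * w + w ^ 2) * four_eq_zero f

lemma mem_GC₀_iff (f : (ZMod 4)[X]) (n : ℕ) (hf : IsBasicPrimitive f n) (x : GR f) :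
    x ∈ GC₀ f n ↔ x ^ 2 ^ n = x := by
  have hn := degree_pos f n hf
  have hsucc : 2 ^ n = (2 ^ n - 1) + 1 := (Nat.sub_add_cancel Nat.one_le_two_pow).symm
  constructor
  · rintro (rfl | ⟨u, hu, rfl⟩)
    · exact zero_pow (by positivity)
    · have : u ^ (2 ^ n - 1) = 1 := hu
      rw [hsucc, pow_succ, ← Units.val_pow_eq_pow_val, this]
      simp
  · intro hx
    have : Fact (Irreducible (f.map red)) := ⟨hf.2.2.1⟩
    by_cases h0 : proj f x = 0
    · left
      obtain ⟨w, rfl⟩ := proj_ker f x h0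
      have := pow_add_two_mul f n hn 0 w
      rw [zero_add, zero_pow (by positivity)] at this
      rw [← hx, this]
    · right
      obtain ⟨v, hv⟩ : ∃ v, proj f v = (proj f x)⁻¹ := by
        obtain ⟨p, hp⟩ := AdjoinRoot.mk_surjective (proj f x)⁻¹
        obtain ⟨q, rfl⟩ := Polynomial.map_surjective red (ZMod.castHom_surjective _) p
        refine ⟨AdjoinRoot.mk f q, ?_⟩
        rw [← hp]
        exact proj_mk f q
      obtain ⟨w, hw⟩ := proj_ker f (x * v - 1) (by
        rw [map_sub, map_mul, hv, map_one, mul_inv_cancel₀ h0, sub_self])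
      have hunit : x * (v * (x * v)) = 1 := by
        linear_combination (x * v + 1 + 2 * w) * hw + (w + w ^ 2) * four_eq_zero f
      let u : (GR f)ˣ := Units.mkOfMulEqOne x _ hunit
      refine ⟨u, ?_, rfl⟩
      change u ^ (2 ^ n - 1) = 1
      have h2 : u ^ 2 ^ n = u := Units.ext (by rw [Units.val_pow_eq_pow_val]; exact hx)
      rw [hsucc, pow_succ] at h2
      exact mul_eq_right.mp h2

/-- Each element of `GR(4,n)` has a unique 2-adic representation `x = x₀ + 2 x₁` with
`x₀, x₁ ∈ G_C ∪ {0}`. -/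
theorem existsUnique_twoAdic (f : (ZMod 4)[X]) (n : ℕ) (hf : IsBasicPrimitive f n) (x : GR f) :
    ∃! p : GR f × GR f, p.1 ∈ GC₀ f n ∧ p.2 ∈ GC₀ f n ∧ x = p.1 + 2 * p.2 := by
  have hn := degree_pos f n hf
  have key : ∀ y : GR f, ∃ w, y = y ^ 2 ^ n + 2 * w := fun y => by
    obtain ⟨w, hw⟩ := proj_ker f (y - y ^ 2 ^ n) (by
      rw [map_sub, map_pow, resField_pow f n hf, sub_self])
    exact ⟨w, by rw [← hw]; ring⟩
  have mem : ∀ y : GR f, y ^ 2 ^ n ∈ GC₀ f n := fun y => by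
    rw [mem_GC₀_iff f n hf]
    obtain ⟨w, hw⟩ := key y
    have h := pow_add_two_mul f n hn (y ^ 2 ^ n) w
    rw [← hw] at h
    exact h.symm
  have uniq : ∀ y z w : GR f, y ∈ GC₀ f n → z ∈ GC₀ f n → y = z + 2 * w → y = z := by
    intro y z w hy hz h
    rw [mem_GC₀_iff f n hf] at hy hz
    rw [← hy, h, pow_add_two_mul f n hn, hz]
  obtain ⟨y, hy⟩ := key x
  obtain ⟨w, hw⟩ := key y
  refine ⟨(x ^ 2 ^ n, y ^ 2 ^ n), ⟨mem x, mem y, ?_⟩, ?_⟩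
  · change x = x ^ 2 ^ n + 2 * y ^ 2 ^ n
    linear_combination hy + 2 * hw + w * four_eq_zero f
  · rintro ⟨a, b⟩ ⟨ha, hb, hab⟩
    simp only at ha hb hab
    have h1 : a = x ^ 2 ^ n := uniq _ _ (y - b) ha (mem x) (by linear_combination hy - hab)
    obtain ⟨c, hc⟩ := two_mul_eq_zero f hf.1 (b - y ^ 2 ^ n) (by
      linear_combination hy - hab - h1 + 2 * hw + w * four_eq_zero f)
    have h2 : b = y ^ 2 ^ n := uniq _ _ c hb (mem y) (by linear_combination hc)
    rw [h1, h2]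

/-! ### Frobenius, traces, and the sequence family -/

/-- The components `(x₀, x₁)` of the unique 2-adic representation of `x`. -/
def twoAdic (f : (ZMod 4)[X]) (n : ℕ) (x : GR f) : GR f × GR f :=
  Classical.epsilon fun p : GR f × GR f => p.1 ∈ GC₀ f n ∧ p.2 ∈ GC₀ f n ∧ x = p.1 + 2 * p.2

theorem twoAdic_spec (f : (ZMod 4)[X]) (n : ℕ) (hf : IsBasicPrimitive f n) (x : GR f) :
    (twoAdic f n x).1 ∈ GC₀ f n ∧ (twoAdic f n x).2 ∈ GC₀ f n ∧
      x = (twoAdic f n x).1 + 2 * (twoAdic f n x).2 :=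
  Classical.epsilon_spec (existsUnique_twoAdic f n hf x).exists

/-- The Frobenius automorphism `σ(x) = x₀^(2^e) + 2 x₁^(2^e)` of `GR(4,n)` over `GR(4,e)`. -/
def frob (f : (ZMod 4)[X]) (n e : ℕ) (x : GR f) : GR f :=
  (twoAdic f n x).1 ^ 2 ^ e + 2 * (twoAdic f n x).2 ^ 2 ^ e

/-- The subring `GR(4,e)` of `GR(4,n)` (for `e ∣ n`), as the fixed set of the Frobenius
automorphism of `GR(4,n)` over `GR(4,e)`. -/
def subGR (f : (ZMod 4)[X]) (n e : ℕ) : Set (GR f) := {x | frob f n e x = x}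

/-- The trace `Tr_e^k(x) = x + σ(x) + ⋯ + σ^(k/e-1)(x)`, where `e ∣ k ∣ n`.  On `GR(4,k)`, viewed
inside `GR(4,n)`, this is the trace from `GR(4,k)` to `GR(4,e)`. -/
def trace (f : (ZMod 4)[X]) (n e k : ℕ) (x : GR f) : GR f :=
  ∑ i ∈ Finset.range (k / e), (frob f n e)^[i] x

/-- The function `P`, for `n = e m`:  with `l = ⌊m/2⌋`,
`P(x) = ∑_{j=1}^{l-1} Tr_1^n(x^(2^(ej)+1)) + Tr_1^{le}(x^(2^(le)+1))` if `m` is even, and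
`P(x) = ∑_{j=1}^{l} Tr_1^n(x^(2^(ej)+1))` if `m` is odd. -/
def P (f : (ZMod 4)[X]) (e m : ℕ) (x : GR f) : GR f :=
  if Even m then
    ∑ j ∈ Finset.Icc 1 (m / 2 - 1), trace f (e * m) 1 (e * m) (x ^ (2 ^ (e * j) + 1)) +
      trace f (e * m) 1 (m / 2 * e) (x ^ (2 ^ (m / 2 * e) + 1))
  else
    ∑ j ∈ Finset.Icc 1 (m / 2), trace f (e * m) 1 (e * m) (x ^ (2 ^ (e * j) + 1))

/-- The value, at `x = β^t`, of the sequence with parameters `λ₀ = c₀` and `λ_k = c (k-1)`,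
`k = 1, …, ρ-1`:
`Tr_1^n((1+2λ₀)x) + 2 ∑_{k=1}^{ρ-1} Tr_1^n(λ_k x^(1+2^k)) + 2 P(λ x)`, as an element of the
Galois ring (in fact of its prime subring `ℤ/4`). -/
def seqValue (f : (ZMod 4)[X]) (e m ρ : ℕ) (lam c₀ : GR f) (c : Fin (ρ - 1) → GR f) (x : GR f) :
    GR f :=
  trace f (e * m) 1 (e * m) ((1 + 2 * c₀) * x) +
    2 * ∑ k : Fin (ρ - 1), trace f (e * m) 1 (e * m) (c k * x ^ (1 + 2 ^ ((k : ℕ) + 1))) +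
    2 * P f e m (lam * x)

/-- The family `𝓛`: the `ℤ/4`-valued sequences `t ↦ seqValue … (β^t)`, one for each choice of
`λ₀, …, λ_{ρ-1} ∈ G_C ∪ {0}`, together with the sequence `t ↦ 2 Tr_1^n(β^t)`. -/
def familyL (f : (ZMod 4)[X]) (e m ρ : ℕ) (lam : GR f) (β : (GR f)ˣ) : Set (ℕ → ZMod 4) :=
  {s | (∃ c₀ ∈ GC₀ f (e * m), ∃ c : Fin (ρ - 1) → GR f, (∀ k, c k ∈ GC₀ f (e * m)) ∧
          ∀ t, algebraMap (ZMod 4) (GR f) (s t) =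
            seqValue f e m ρ lam c₀ c ((β : GR f) ^ t)) ∨
       ∀ t, algebraMap (ZMod 4) (GR f) (s t) =
          2 * trace f (e * m) 1 (e * m) ((β : GR f) ^ t)}

end Quadriphase

end

/-! Only the term with unit coefficient sees the full ring: every other term carries a factor 2, and
2x depends only on the residue of x. Writing β^t as the Teichmüller lift of a power of a generator
of GF(2^n)*, each sequence becomes the restriction to nonzero x of a ℤ/4-valued quadratic form on
GF(2^n) (`seqValue_teich`, `familyL_eq_range`). The ℤ/4 refinement of the trace comes from the carry
in adding Teichmüller lifts (`teich_sq_add_sq`, `conjSum_add`).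

A difference of two shifted sequences is again such a form, `corrForm`, with polarization Tr(y
L(x)). A correlation is its complete exponential sum S minus the term at 0, and |S|² is at most 2^n
times the size of the radical, the kernel of L (`norm_sum_addChar_sq_le`).

Put r = ρ - 1. Up to terms containing relative traces E to GF(2^e), L is a linearized polynomial
which, raised to the power 2^r, has degree at most 2^(2r). P is chosen so that its polarization is
exactly E(x) + x. Fixing E(ux) and E((u+v)x) leaves at most 2^(2r) points of the radical, since for
u ≠ v the linear coefficient (u+v)²(1+λ²) is nonzero. The first value lies in GF(2^e); on the
radical Tr((u+v)x) = 0, so the second has absolute trace 0. This gives at most 2^(2r)·2^e·2^(e-1)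
points (`card_radical_le_of_ne`), and the factor lost in the trace condition makes the bound strict.
For u = v the relative traces cancel, and the sum is bounded more easily or is that of a nontrivial
character.

Size, cyclic distinctness and least period all follow from one fact: the form vanishes identically
only if its coefficients are trivial (`eq_zero_of_corrForm_eq_zero`). -/

noncomputable section

namespace Quadriphase

/-! ### Exponential sums of `ℤ/4`-valued quadratic forms -/

/-- The map `ℤ/2 → ℤ/4` induced by multiplication by 2. -/
def twice : ZMod 2 →+ ZMod 4 where
  toFun r := if r = 0 then 0 else 2
  map_zero' := rfl
  map_add' := by decide

lemma twice_red (a : ZMod 4) : twice (red a) = 2 * a := by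
  revert a; decide

lemma red_twice (r : ZMod 2) : red (twice r) = 0 := by
  revert r; decide

lemma twice_injective : Function.Injective twice := by
  decide

lemma neg_twice (r : ZMod 2) : -twice r = twice r := by
  revert r; decide

/-- Substituting x = z + y in the double sum for |S|² gives χ(q z) χ(2 D(z, y)). For fixed z this is
a character in y, nontrivial unless D z = 0 because χ 2 ≠ 1, so only the radical contributes. -/
lemma norm_sum_addChar_sq_le {V : Type*} [AddCommGroup V] [Fintype V] (χ : AddChar (ZMod 4) ℂ)
    (hχ : χ 2 ≠ 1) (q : V → ZMod 4) (D : V →+ V →+ ZMod 2)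
    (hq : ∀ x y, q (x + y) = q x + q y + twice (D x y)) (s : Finset V)
    (hs : ∀ x, D x = 0 → x ∈ s) :
    ‖∑ x, χ (q x)‖ ^ 2 ≤ Fintype.card V * s.card := by
  classical
  have inner_sum : ∀ z : V, ∑ y, χ (twice (D z y)) = if D z = 0 then (Fintype.card V : ℂ) else 0 := by
    intro z
    let ψ : AddChar V ℂ := χ.compAddMonoidHom (twice.comp (D z))
    have hψ : ψ = 1 ↔ D z = 0 := by
      constructor
      · intro h
        ext y
        by_contra hy
        have h1 : χ (twice (D z y)) = 1 := by
          have := DFunLike.congr_fun h y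
          simpa [ψ] using this
        have h2 : D z y = 1 := by
          have hall : ∀ r : ZMod 2, r ≠ 0 → r = 1 := by decide
          exact hall _ hy
        rw [h2] at h1
        exact hχ h1
      · intro h
        ext y
        simp [ψ, h]
    have : ∑ y, ψ y = if ψ = 1 then (Fintype.card V : ℂ) else 0 := by
      rw [AddChar.sum_eq_ite]
      rfl
    simp only [hψ] at this
    exact this
  have expand : (∑ x, χ (q x)) * (starRingEnd ℂ) (∑ x, χ (q x)) =
      Fintype.card V * ∑ z ∈ Finset.univ.filter (fun z => D z = 0), χ (q z) := by
    rw [map_sum, Finset.mul_sum]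
    have h1 : ∀ y, (∑ x, χ (q x)) * (starRingEnd ℂ) (χ (q y)) =
        ∑ z, χ (q z) * χ (twice (D z y)) := by
      intro y
      rw [← Equiv.sum_comp (Equiv.addRight y) (fun x => χ (q x)), Finset.sum_mul]
      refine Finset.sum_congr rfl fun z _ => ?_
      rw [← AddChar.map_neg_eq_conj, ← AddChar.map_add_eq_mul, ← AddChar.map_add_eq_mul,
        Equiv.coe_addRight, hq]
      congr 1
      ring
    simp_rw [h1]
    rw [Finset.sum_comm]
    simp_rw [← Finset.mul_sum, inner_sum]
    rw [Finset.mul_sum, Finset.sum_filter]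
    refine Finset.sum_congr rfl fun z _ => ?_
    split_ifs <;> ring
  have hnorm : ∀ a, ‖χ a‖ = 1 := fun a => AddChar.norm_apply χ a
  have h2 := congrArg norm expand
  rw [norm_mul, RCLike.norm_conj, ← sq, norm_mul, Complex.norm_natCast] at h2
  rw [h2]
  refine mul_le_mul_of_nonneg_left ?_ (Nat.cast_nonneg _)
  refine (norm_sum_le _ _).trans ?_
  simp only [hnorm, Finset.sum_const, nsmul_eq_mul, mul_one]
  exact_mod_cast Finset.card_le_card fun x hx => hs x (by simpa using hx)

/-! ### Linearized polynomials -/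

/-- Distinct exponents prevent cancellation, so one nonzero coefficient makes the polynomial
nonzero. The constant `c` allows fibres to be counted as well as kernels. -/
lemma card_le_of_linearized {F ι : Type*} [Field F] [Fintype ι] (ε : ι → ℕ)
    (hε : Function.Injective ε) (N : ℕ) (hN : ∀ i, ε i ≤ N) (a : ι → F) (i : ι) (hi : a i ≠ 0)
    (c : F) (s : Finset F) (hs : ∀ x ∈ s, ∑ i, a i * x ^ 2 ^ ε i = c) : s.card ≤ 2 ^ N := by
  classical
  let p : F[X] := ∑ i, C (a i) * X ^ 2 ^ ε i - C c
  have hp : p ≠ 0 := by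
    intro h
    have hcoeff : p.coeff (2 ^ ε i) = a i := by
      have h0 : (C c).coeff (2 ^ ε i) = 0 := coeff_C_of_ne_zero (by positivity)
      simp only [p, coeff_sub, h0, finsetSum_coeff, coeff_C_mul, coeff_X_pow, sub_zero]
      rw [Finset.sum_eq_single i]
      · simp
      · intro j _ hj
        rw [if_neg, mul_zero]
        intro h
        exact hj (hε (Nat.pow_right_injective le_rfl h)).symm
      · simp
    rw [h, coeff_zero] at hcoeff
    exact hi hcoeff.symm
  have hdeg : p.natDegree ≤ 2 ^ N := by
    refine (natDegree_sub_le _ _).trans (max_le ?_ (by simp))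
    refine natDegree_sum_le_of_forall_le _ _ fun j _ => ?_
    exact (natDegree_C_mul_X_pow_le _ _).trans (Nat.pow_le_pow_right (by norm_num) (hN j))
  have hsub : s ⊆ p.roots.toFinset := by
    intro x hx
    rw [Multiset.mem_toFinset, mem_roots hp, IsRoot, eval_sub, eval_finsetSum]
    simp [hs x hx]
  calc s.card ≤ p.roots.toFinset.card := Finset.card_le_card hsub
    _ ≤ p.roots.card := Multiset.toFinset_card_le _
    _ ≤ p.natDegree := card_roots' p
    _ ≤ 2 ^ N := hdeg

/-! ### Traces, linearized polynomials and the form P in characteristic 2 -/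

section Field

variable {F : Type*} [Field F]

/-- Squaring permutes the conjugates cyclically. The function `g` is arbitrary so that this also
applies to sums of Teichmüller lifts. -/
lemma sum_pow_succ_eq {M : Type*} [AddCommMonoid M] {n : ℕ} (g : F → M) {x : F}
    (hx : x ^ 2 ^ n = x) :
    ∑ i ∈ Finset.range n, g ((x ^ 2) ^ 2 ^ i) = ∑ i ∈ Finset.range n, g (x ^ 2 ^ i) := by
  simp_rw [← pow_mul, ← pow_succ']
  cases n with
  | zero => rfl
  | succ n =>
    rw [Finset.sum_range_succ, Finset.sum_range_succ' (fun i => g (x ^ 2 ^ i)), hx, pow_zero,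
      pow_one]

/-- The relative trace `∑_{j<m} x^(2^(ej))`. -/
def relTrace (e m : ℕ) (x : F) : F := ∑ j ∈ Finset.range m, x ^ 2 ^ (e * j)

lemma relTrace_mul (e m : ℕ) (a x : F) (ha : a ^ 2 ^ e = a) :
    relTrace e m (a * x) = a * relTrace e m x := by
  have h : ∀ j, a ^ 2 ^ (e * j) = a := by
    intro j
    induction j with
    | zero => simp
    | succ j ih => rw [Nat.mul_succ, pow_add, pow_mul, ih, ha]
  simp only [relTrace, mul_pow, h, Finset.mul_sum]

/-- The absolute trace `∑_{i<n} x^(2^i)`. -/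
def absTrace (n : ℕ) (x : F) : F := ∑ i ∈ Finset.range n, x ^ 2 ^ i

lemma absTrace_pow {n : ℕ} (hn : ∀ x : F, x ^ 2 ^ n = x) (x : F) (k : ℕ) :
    absTrace n (x ^ 2 ^ k) = absTrace n x := by
  induction k with
  | zero => simp
  | succ k ih =>
    rw [pow_succ, pow_mul, ← ih]
    exact sum_pow_succ_eq id (hn _)

variable [CharP F 2]

lemma add_pow_two_pow (x y : F) (k : ℕ) : (x + y) ^ 2 ^ k = x ^ 2 ^ k + y ^ 2 ^ k :=
  add_pow_char_pow x y 2 k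

lemma sum_pow_two_pow {ι : Type*} (s : Finset ι) (g : ι → F) (k : ℕ) :
    (∑ i ∈ s, g i) ^ 2 ^ k = ∑ i ∈ s, g i ^ 2 ^ k :=
  sum_pow_char_pow 2 k s g

/-- The linearized polynomial `∑ (γ_k x^(2^k) + (γ_k x)^(2^(n-k))) + d x`. -/
def polarPoly (n : ℕ) {r : ℕ} (γ : Fin r → F) (d x : F) : F :=
  ∑ k : Fin r, (γ k * x ^ 2 ^ (k + 1 : ℕ) + (γ k * x) ^ 2 ^ (n - (k + 1))) + d * x

lemma card_le_of_polarPoly {n r : ℕ} (hn : ∀ x : F, x ^ 2 ^ n = x) (hr : r ≤ n) (γ : Fin r → F)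
    (d : F) (hγ : d ≠ 0 ∨ γ ≠ 0) (c : F) (s : Finset F) (hs : ∀ x ∈ s, polarPoly n γ d x = c) :
    s.card ≤ 2 ^ (2 * r) := by
  -- Raising to the power 2^r and using x^(2^n) = x turns the exponents k+1, n-(k+1) and 0 of 2 into
  -- r+(k+1), r-(k+1) and r: all distinct and at most 2r.
  let ε : Option (Fin r ⊕ Fin r) → ℕ
    | none => r
    | some (Sum.inl k) => r + (k + 1)
    | some (Sum.inr k) => r - (k + 1)
  let a : Option (Fin r ⊕ Fin r) → F
    | none => d ^ 2 ^ r
    | some (Sum.inl k) => γ k ^ 2 ^ r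
    | some (Sum.inr k) => γ k ^ 2 ^ (r - (k + 1))
  have hε : Function.Injective ε := by
    rintro (_ | x | x) (_ | y | y) h <;> simp only [ε] at h
    · rfl
    · omega
    · omega
    · omega
    · congr 2; ext; omega
    · omega
    · omega
    · omega
    · congr 2; ext; omega
  have hN : ∀ i, ε i ≤ 2 * r := by
    rintro (_ | x | x) <;> simp only [ε] <;> omega
  obtain ⟨i, hi⟩ : ∃ i, a i ≠ 0 := by
    rcases hγ with h | h
    · exact ⟨none, pow_ne_zero _ h⟩
    · obtain ⟨k, hk⟩ := Function.ne_iff.mp h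
      exact ⟨some (Sum.inl k), pow_ne_zero _ hk⟩
  refine card_le_of_linearized ε hε _ hN a i hi (c ^ 2 ^ r) s fun x hx => ?_
  rw [← hs x hx, polarPoly, add_pow_two_pow, sum_pow_two_pow, Fintype.sum_option,
    Fintype.sum_sum_type, ← Finset.sum_add_distrib, add_comm]
  congr 1
  · refine Finset.sum_congr rfl fun k _ => ?_
    simp only [a, ε]
    rw [add_pow_two_pow]
    congr 1
    · rw [mul_pow, ← pow_mul, ← pow_add, add_comm r]
    · rw [← mul_pow, ← pow_mul, ← pow_add,
        show n - (k + 1 : ℕ) + r = n + (r - (k + 1)) by omega, pow_add, pow_mul, hn]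
  · simp only [a, ε]
    rw [mul_pow]

lemma relTrace_add (e m : ℕ) (x y : F) :
    relTrace e m (x + y) = relTrace e m x + relTrace e m y := by
  simp only [relTrace, add_pow_two_pow, Finset.sum_add_distrib]

lemma relTrace_pow (e m : ℕ) (hem : ∀ x : F, x ^ 2 ^ (e * m) = x) (x : F) :
    relTrace e m x ^ 2 ^ e = relTrace e m x := by
  rw [relTrace, sum_pow_two_pow]
  simp_rw [← pow_mul, ← pow_add, ← Nat.mul_succ]
  cases m with
  | zero => rfl
  | succ m =>
    rw [Finset.sum_range_succ, Finset.sum_range_succ' (fun i => x ^ 2 ^ (e * i)), hem]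
    simp

lemma sum_relTrace_pow (e m : ℕ) (x : F) :
    ∑ i ∈ Finset.range e, relTrace e m x ^ 2 ^ i = ∑ i ∈ Finset.range (e * m), x ^ 2 ^ i := by
  simp_rw [relTrace, sum_pow_two_pow]
  rw [Finset.sum_comm]
  induction m with
  | zero => simp
  | succ m ih =>
    rw [Finset.sum_range_succ, ih, Nat.mul_succ, Finset.sum_range_add]
    simp_rw [← pow_mul, ← pow_add]

lemma polarPoly_add (n : ℕ) {r : ℕ} (γ : Fin r → F) (d x y : F) :
    polarPoly n γ d (x + y) = polarPoly n γ d x + polarPoly n γ d y := by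
  simp only [polarPoly, mul_add, add_pow_two_pow, Finset.sum_add_distrib]
  ring

lemma absTrace_add (n : ℕ) (x y : F) : absTrace n (x + y) = absTrace n x + absTrace n y := by
  simp only [absTrace, add_pow_two_pow, Finset.sum_add_distrib]

lemma absTrace_sum {ι : Type*} (n : ℕ) (s : Finset ι) (g : ι → F) :
    absTrace n (∑ i ∈ s, g i) = ∑ i ∈ s, absTrace n (g i) := by
  simp only [absTrace, sum_pow_two_pow]
  exact Finset.sum_comm

lemma absTrace_sq {n : ℕ} {x : F} (hx : x ^ 2 ^ n = x) : absTrace n x ^ 2 = absTrace n x := by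
  rw [← pow_one 2, absTrace, sum_pow_two_pow, pow_one]
  refine Eq.trans (Finset.sum_congr rfl fun i _ => ?_) (sum_pow_succ_eq id hx)
  exact pow_right_comm _ _ _

/-- The cross term x·y^(2^k) is conjugated by 2^(n-k), so that y occurs only to the first power and
the polarization has the shape Tr(y L(x)). -/
lemma absTrace_pow_add {n : ℕ} (hn : ∀ x : F, x ^ 2 ^ n = x) (x y : F) {k : ℕ} (hk : k ≤ n) :
    absTrace n ((x + y) ^ (2 ^ k + 1)) = absTrace n (x ^ (2 ^ k + 1)) +
      absTrace n (y ^ (2 ^ k + 1)) +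
      (absTrace n (y * x ^ 2 ^ k) + absTrace n (y * x ^ 2 ^ (n - k))) := by
  have h : absTrace n (y * x ^ 2 ^ (n - k)) = absTrace n (x * y ^ 2 ^ k) := by
    rw [← absTrace_pow hn (x * y ^ 2 ^ k) (n - k), mul_pow, ← pow_mul, ← pow_add,
      Nat.add_sub_cancel' hk, hn, mul_comm]
  rw [h, ← absTrace_add, ← absTrace_add, ← absTrace_add]
  congr 1
  rw [pow_succ, pow_succ, pow_succ, add_pow_two_pow]
  ring

/-- At the middle exponent the two cross terms are conjugate under 2^k, so their half-length traces
add up to one full trace. This is why P uses a trace from the half-degree subfield there. -/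
lemma absTrace_half_add {k n : ℕ} (hkn : n = k + k) (hn : ∀ x : F, x ^ 2 ^ n = x) (x y : F) :
    absTrace k ((x + y) ^ (2 ^ k + 1)) = absTrace k (x ^ (2 ^ k + 1)) +
      absTrace k (y ^ (2 ^ k + 1)) + absTrace n (y * x ^ 2 ^ k) := by
  have h : (y * x ^ 2 ^ k) ^ 2 ^ k = x * y ^ 2 ^ k := by
    rw [mul_pow, ← pow_mul, ← pow_add, ← hkn, hn, mul_comm]
  have h2 : absTrace n (y * x ^ 2 ^ k) =
      absTrace k (y * x ^ 2 ^ k) + absTrace k (x * y ^ 2 ^ k) := by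
    rw [← h, absTrace, hkn, Finset.sum_range_add, absTrace, absTrace]
    simp_rw [← pow_mul, ← pow_add]
  rw [h2, ← absTrace_add, ← absTrace_add, ← absTrace_add]
  congr 1
  rw [pow_succ, pow_succ, pow_succ, add_pow_two_pow]
  ring

/-- The reduction modulo 2 of the function `P`. -/
def altSum (e m : ℕ) (x : F) : F :=
  if Even m then
    ∑ j ∈ Finset.Icc 1 (m / 2 - 1), absTrace (e * m) (x ^ (2 ^ (e * j) + 1)) +
      absTrace (m / 2 * e) (x ^ (2 ^ (m / 2 * e) + 1))
  else
    ∑ j ∈ Finset.Icc 1 (m / 2), absTrace (e * m) (x ^ (2 ^ (e * j) + 1))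

lemma altSum_sq {e m : ℕ} (hn : ∀ x : F, x ^ 2 ^ (e * m) = x) (x : F) :
    altSum e m x ^ 2 = altSum e m x := by
  have h : ∀ (s : Finset ℕ) (g : ℕ → F),
      (∑ j ∈ s, absTrace (e * m) (g j)) ^ 2 = ∑ j ∈ s, absTrace (e * m) (g j) := by
    intro s g
    rw [← absTrace_sum, absTrace_sq (hn _)]
  rw [altSum]
  split_ifs with hm
  · obtain ⟨l, rfl⟩ := hm
    rw [CharTwo.add_sq, h, absTrace_sq]
    -- The power x^(2^(le)+1) is the norm to the subfield with 2^(le) elements, hence fixed by the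
    -- le-th Frobenius power.
    rw [← pow_mul, add_mul, one_mul, ← pow_add, pow_add,
      show (l + l) / 2 * e + (l + l) / 2 * e = e * (l + l) by
        rw [show (l + l) / 2 = l by omega]; ring, hn, pow_succ, mul_comm]
  · exact h _ _

lemma sum_Ico_eq_of_even {M : Type*} [AddCommMonoid M] (g : ℕ → M) {l : ℕ} (hl : 0 < l) :
    ∑ j ∈ Finset.Icc 1 (l - 1), (g j + g (2 * l - j)) + g l = ∑ j ∈ Finset.Ico 1 (2 * l), g j := by
  obtain ⟨k, rfl⟩ := Nat.exists_eq_succ_of_ne_zero hl.ne'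
  have h : Finset.Icc 1 (k.succ - 1) = Finset.Ico 1 (k + 1) := by
    ext; simp only [Finset.mem_Icc, Finset.mem_Ico]; omega
  rw [h, Finset.sum_add_distrib, Finset.sum_Ico_reflect _ _ (by omega),
    ← Finset.sum_Ico_consecutive g (show 1 ≤ k + 1 by omega) (show k + 1 ≤ 2 * k.succ by omega),
    Finset.sum_eq_sum_Ico_succ_bot (show k + 1 < 2 * k.succ by omega), add_assoc, add_comm _ (g _),
    show 2 * k.succ + 1 - (k + 1) = k + 1 + 1 by omega, Nat.add_sub_cancel]

lemma sum_Ico_eq_of_odd {M : Type*} [AddCommMonoid M] (g : ℕ → M) (l : ℕ) :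
    ∑ j ∈ Finset.Icc 1 l, (g j + g (2 * l + 1 - j)) = ∑ j ∈ Finset.Ico 1 (2 * l + 1), g j := by
  have h : Finset.Icc 1 l = Finset.Ico 1 (l + 1) := by
    ext; simp only [Finset.mem_Icc, Finset.mem_Ico]; omega
  rw [h, Finset.sum_add_distrib, Finset.sum_Ico_reflect _ _ (by omega),
    ← Finset.sum_Ico_consecutive g (show 1 ≤ l + 1 by omega) (show l + 1 ≤ 2 * l + 1 by omega),
    show 2 * l + 1 + 1 - (l + 1) = l + 1 by omega, Nat.add_sub_cancel]

/-- Pairing j with m - j, the cross terms run over each x^(2^(ej)), 1 ≤ j < m, exactly once. This is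
the relative trace without its term j = 0, and adding x removes that term in characteristic 2. -/
lemma altSum_add {e m : ℕ} (hm0 : 0 < m) (hn : ∀ x : F, x ^ 2 ^ (e * m) = x) (x y : F) :
    altSum e m (x + y) = altSum e m x + altSum e m y +
      absTrace (e * m) (y * (relTrace e m x + x)) := by
  have h1 : absTrace (e * m) (y * (relTrace e m x + x)) =
      ∑ j ∈ Finset.Ico 1 m, absTrace (e * m) (y * x ^ 2 ^ (e * j)) := by
    rw [← absTrace_sum, ← Finset.mul_sum, relTrace, Finset.range_eq_Ico,
      Finset.sum_eq_sum_Ico_succ_bot hm0, mul_zero, pow_zero, pow_one, add_comm x,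
      add_assoc, CharTwo.add_self_eq_zero, add_zero]
  have h2 : ∀ t < m, ∑ j ∈ Finset.Icc 1 t, absTrace (e * m) ((x + y) ^ (2 ^ (e * j) + 1)) =
      ∑ j ∈ Finset.Icc 1 t, absTrace (e * m) (x ^ (2 ^ (e * j) + 1)) +
      ∑ j ∈ Finset.Icc 1 t, absTrace (e * m) (y ^ (2 ^ (e * j) + 1)) +
      ∑ j ∈ Finset.Icc 1 t, (absTrace (e * m) (y * x ^ 2 ^ (e * j)) +
        absTrace (e * m) (y * x ^ 2 ^ (e * (m - j)))) := by
    intro t ht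
    rw [← Finset.sum_add_distrib, ← Finset.sum_add_distrib]
    refine Finset.sum_congr rfl fun j hj => ?_
    rw [absTrace_pow_add hn _ _ (Nat.mul_le_mul_left e (by simp at hj; omega)), Nat.mul_sub]
  rw [h1, altSum, altSum, altSum]
  split_ifs with hm
  · obtain ⟨l, rfl⟩ := hm
    have hl : (l + l) / 2 = l := by omega
    rw [hl, h2 _ (by omega), absTrace_half_add (n := e * (l + l)) (by ring) hn, ← two_mul,
      ← sum_Ico_eq_of_even _ (by omega : 0 < l), mul_comm l e]
    ring
  · obtain ⟨l, rfl⟩ := Nat.not_even_iff_odd.mp hm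
    rw [show (2 * l + 1) / 2 = l by omega, h2 _ (by omega),
      ← sum_Ico_eq_of_odd]

end Field

/-! ### Quadratic forms on a finite field: radicals and exponential sums -/

section FiniteField

variable {F : Type*} [Field F] [Fintype F] [Algebra (ZMod 2) F]

lemma algebraMap_trace_eq {n : ℕ} (hn : Fintype.card F = 2 ^ n) (x : F) :
    algebraMap (ZMod 2) F (Algebra.trace (ZMod 2) F x) = ∑ i ∈ Finset.range n, x ^ 2 ^ i := by
  have hfin : Module.finrank (ZMod 2) F = n := by
    have h := Module.card_eq_pow_finrank (K := ZMod 2) (V := F)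
    rw [ZMod.card, hn] at h
    exact (Nat.pow_right_injective le_rfl h).symm
  rw [FiniteField.algebraMap_trace_eq_sum_pow, hfin]
  simp

lemma trace_pow_two_pow {n : ℕ} (hn : Fintype.card F = 2 ^ n) (x : F) (k : ℕ) :
    Algebra.trace (ZMod 2) F (x ^ 2 ^ k) = Algebra.trace (ZMod 2) F x := by
  apply (algebraMap (ZMod 2) F).injective
  rw [algebraMap_trace_eq hn, algebraMap_trace_eq hn]
  exact absTrace_pow (fun x => by rw [← hn, FiniteField.pow_card]) x k

lemma eq_zero_of_trace_mul_eq_zero (a : F)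
    (h : ∀ w, Algebra.trace (ZMod 2) F (w * a) = 0) : a = 0 := by
  have := traceForm_nondegenerate (ZMod 2) F
  refine this.1 a fun w => ?_
  rw [Algebra.traceForm_apply, mul_comm]
  exact h w

/-- A `ℤ/4`-valued quadratic form refining the absolute trace of `F`, together with a `ℤ/2`-valued
quadratic form with polarization `Tr(y (E x + x))`, where `E` is the relative trace to the subfield
with `2^e` elements, and an element `lam` of that subfield. -/
structure TraceForms (F : Type*) [Field F] [Fintype F] [Algebra (ZMod 2) F] (n e m : ℕ) where
  card_eq : Fintype.card F = 2 ^ n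
  deg_eq : n = e * m
  quad : F → ZMod 4
  quad_add : ∀ x y, quad (x + y) = quad x + quad y + twice (Algebra.trace (ZMod 2) F (x * y))
  red_quad : ∀ x, red (quad x) = Algebra.trace (ZMod 2) F x
  alt : F → ZMod 2
  alt_add : ∀ x y, alt (x + y) =
    alt x + alt y + Algebra.trace (ZMod 2) F (y * (relTrace e m x + x))
  lam : F
  lam_pow : lam ^ 2 ^ e = lam
  lam_ne_one : lam ≠ 1

namespace TraceForms

variable {n e m r : ℕ} (A : TraceForms F n e m)

lemma pow_card (A : TraceForms F n e m) (x : F) : x ^ 2 ^ n = x := by rw [← A.card_eq, FiniteField.pow_card]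

/-- The sequence values `Q(ux) + 2 (Tr(gx) + ∑ Tr(γ_k x^(1+2^k)) + P(λux))`. -/
def seqForm (u g : F) (γ : Fin r → F) (x : F) : ZMod 4 :=
  A.quad (u * x) + twice (Algebra.trace (ZMod 2) F (g * x) +
    ∑ k : Fin r, Algebra.trace (ZMod 2) F (γ k * x ^ (1 + 2 ^ ((k : ℕ) + 1))) +
    A.alt (A.lam * (u * x)))

/-- The difference of two sequence values. -/
def corrForm (u v g : F) (γ : Fin r → F) (x : F) : ZMod 4 :=
  A.quad (u * x) - A.quad (v * x) + twice (Algebra.trace (ZMod 2) F (g * x) +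
    ∑ k : Fin r, Algebra.trace (ZMod 2) F (γ k * x ^ (1 + 2 ^ ((k : ℕ) + 1))) +
    A.alt (A.lam * (u * x)) + A.alt (A.lam * (v * x)))

/-- The shift factor `y` is absorbed into the coefficients, and signs of doubled terms vanish since
-2 = 2 in ℤ/4. -/
lemma seqForm_sub (u u' g g' y : F) (γ γ' : Fin r → F) (x : F) :
    A.seqForm u g γ x - A.seqForm u' g' γ' (y * x) =
      A.corrForm u (u' * y) (g + g' * y)
        (fun k => γ k + γ' k * y ^ (1 + 2 ^ ((k : ℕ) + 1))) x := by
  simp only [seqForm, corrForm, add_mul, mul_pow, map_add, Finset.sum_add_distrib, mul_assoc]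
  have h : ∀ r, -twice r = twice r := neg_twice
  linear_combination h (Algebra.trace (ZMod 2) F (g' * (y * x))) +
    h (∑ k : Fin r, Algebra.trace (ZMod 2) F
      (γ' k * (y ^ (1 + 2 ^ ((k : ℕ) + 1)) * x ^ (1 + 2 ^ ((k : ℕ) + 1))))) +
    h (A.alt (A.lam * (u' * (y * x))))

lemma quad_zero (A : TraceForms F n e m) : A.quad 0 = 0 := by
  have := A.quad_add 0 0
  simpa using this

lemma alt_zero (A : TraceForms F n e m) : A.alt 0 = 0 := by
  have := A.alt_add 0 0
  simpa using this

lemma corrForm_zero (u v g : F) (γ : Fin r → F) : A.corrForm u v g γ 0 = 0 := by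
  simp [corrForm, A.quad_zero, A.alt_zero]

lemma red_corrForm (u v g : F) (γ : Fin r → F) (x : F) :
    red (A.corrForm u v g γ x) = Algebra.trace (ZMod 2) F ((u + v) * x) := by
  rw [corrForm, map_add, red_twice, add_zero, map_sub, A.red_quad, A.red_quad, CharTwo.sub_eq_add,
    add_mul, map_add]

lemma alt_mul_add (u x y : F) : A.alt (A.lam * (u * (x + y))) =
    A.alt (A.lam * (u * x)) + A.alt (A.lam * (u * y)) + Algebra.trace (ZMod 2) F
      (y * (A.lam ^ 2 * u * relTrace e m (u * x) + A.lam ^ 2 * u ^ 2 * x)) := by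
  rw [mul_add, mul_add, A.alt_add, relTrace_mul e m _ _ A.lam_pow]
  congr 2
  ring

variable [CharP F 2]

/-- The linear map representing the polarization of `corrForm` by the trace form. -/
def polarMap (u v : F) (γ : Fin r → F) (x : F) : F :=
  polarPoly n γ ((u + v) ^ 2 * (1 + A.lam ^ 2)) x +
    A.lam ^ 2 * (u * relTrace e m (u * x) + v * relTrace e m (v * x))

lemma polarMap_add (u v : F) (γ : Fin r → F) (x y : F) :
    A.polarMap u v γ (x + y) = A.polarMap u v γ x + A.polarMap u v γ y := by
  simp only [polarMap, polarPoly_add, mul_add, relTrace_add]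
  ring

lemma trace_pow_add (A : TraceForms F n e m) (γ x y : F) {k : ℕ} (hk : k ≤ n) :
    Algebra.trace (ZMod 2) F (γ * (x + y) ^ (1 + 2 ^ k)) =
      Algebra.trace (ZMod 2) F (γ * x ^ (1 + 2 ^ k)) +
      Algebra.trace (ZMod 2) F (γ * y ^ (1 + 2 ^ k)) +
      Algebra.trace (ZMod 2) F (y * (γ * x ^ 2 ^ k + (γ * x) ^ 2 ^ (n - k))) := by
  have h : Algebra.trace (ZMod 2) F (y * (γ * x) ^ 2 ^ (n - k)) =
      Algebra.trace (ZMod 2) F (γ * x * y ^ 2 ^ k) := by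
    rw [← trace_pow_two_pow A.card_eq (γ * x * y ^ 2 ^ k) (n - k), mul_pow _ (y ^ 2 ^ k),
      ← pow_mul, ← pow_add, Nat.add_sub_cancel' hk, A.pow_card, mul_comm]
  rw [mul_add y, map_add _ (y * _), h, ← map_add, ← map_add, ← map_add]
  congr 1
  rw [pow_add, pow_add, pow_add, add_pow_two_pow]
  ring

lemma corrForm_add (hr : r ≤ n) (u v g : F) (γ : Fin r → F) (x y : F) :
    A.corrForm u v g γ (x + y) = A.corrForm u v g γ x + A.corrForm u v g γ y +
      twice (Algebra.trace (ZMod 2) F (y * A.polarMap u v γ x)) := by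
  have h1 : ∑ k : Fin r, Algebra.trace (ZMod 2) F (γ k * (x + y) ^ (1 + 2 ^ ((k : ℕ) + 1))) =
      ∑ k : Fin r, Algebra.trace (ZMod 2) F (γ k * x ^ (1 + 2 ^ ((k : ℕ) + 1))) +
      ∑ k : Fin r, Algebra.trace (ZMod 2) F (γ k * y ^ (1 + 2 ^ ((k : ℕ) + 1))) +
      Algebra.trace (ZMod 2) F (y * ∑ k : Fin r,
        (γ k * x ^ 2 ^ (k + 1 : ℕ) + (γ k * x) ^ 2 ^ (n - (k + 1)))) := by
    rw [Finset.mul_sum, map_sum, ← Finset.sum_add_distrib, ← Finset.sum_add_distrib]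
    refine Finset.sum_congr rfl fun k _ => A.trace_pow_add _ _ _ (by omega)
  -- The linear terms u²x + v²x from `quad` and λ²(u²x + v²x) from `alt` combine to (u+v)²(1+λ²)x.
  have h2 : y * A.polarMap u v γ x =
      (u * x * (u * y) + v * x * (v * y)) +
      y * ∑ k : Fin r, (γ k * x ^ 2 ^ (k + 1 : ℕ) + (γ k * x) ^ 2 ^ (n - (k + 1))) +
      y * (A.lam ^ 2 * u * relTrace e m (u * x) + A.lam ^ 2 * u ^ 2 * x) +
      y * (A.lam ^ 2 * v * relTrace e m (v * x) + A.lam ^ 2 * v ^ 2 * x) := by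
    rw [polarMap, polarPoly, CharTwo.add_sq]
    ring
  rw [h2]
  simp only [corrForm, h1, A.alt_mul_add]
  rw [mul_add u, mul_add v, mul_add g, A.quad_add, A.quad_add]
  simp only [map_add]
  linear_combination neg_twice (Algebra.trace (ZMod 2) F (v * x * (v * y)))

/-- The polarization of `corrForm`. -/
def polarForm (u v : F) (γ : Fin r → F) : F →+ F →+ ZMod 2 :=
  AddMonoidHom.mk' (fun x => AddMonoidHom.mk'
    (fun y => Algebra.trace (ZMod 2) F (y * A.polarMap u v γ x))
    (fun y z => by rw [add_mul, map_add]))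
    (fun x y => by ext z; simp [polarMap_add, mul_add])

lemma polarMap_eq_zero (u v : F) (γ : Fin r → F) {x : F} (h : A.polarForm u v γ x = 0) :
    A.polarMap u v γ x = 0 :=
  eq_zero_of_trace_mul_eq_zero _ fun w => DFunLike.congr_fun h w

/-- Evaluating the form at x + x = 0 shows that twice its value at a radical point is 0; the value
is then even, and its reduction is this trace. -/
lemma trace_eq_zero_of_polarForm (hr : r ≤ n) (u v : F) (γ : Fin r → F) {x : F}
    (h : A.polarForm u v γ x = 0) : Algebra.trace (ZMod 2) F ((u + v) * x) = 0 := by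
  have h1 := A.corrForm_add hr u v 0 γ x x
  have h2 : Algebra.trace (ZMod 2) F (x * A.polarMap u v γ x) = 0 := DFunLike.congr_fun h x
  rw [CharTwo.add_self_eq_zero, corrForm_zero, h2, map_zero, add_zero, ← two_mul, ← twice_red] at h1
  rw [← A.red_corrForm u v 0 γ]
  exact twice_injective (by rw [← h1, map_zero])

lemma polarMap_self (u : F) (γ : Fin r → F) (x : F) :
    A.polarMap u u γ x = polarPoly n γ 0 x := by
  rw [polarMap, CharTwo.add_self_eq_zero, CharTwo.add_self_eq_zero]
  simp

lemma card_radical_le_of_eq (hr : r ≤ n) (u : F) (γ : Fin r → F) (hγ : γ ≠ 0) (s : Finset F)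
    (hs : ∀ x ∈ s, A.polarForm u u γ x = 0) : s.card ≤ 2 ^ (2 * r) :=
  card_le_of_polarPoly A.pow_card hr γ 0 (Or.inr hγ) 0 s fun x hx => by
    rw [← A.polarMap_self u, A.polarMap_eq_zero _ _ _ (hs x hx)]

/-- The radical is fibred over the two relative traces: the image is small by the trace condition,
and on each fibre the relative traces are constants, leaving an affine linearized equation. -/
lemma card_radical_le_of_ne (he : 0 < e) (hr : r ≤ n) {u v : F} (huv : u ≠ v) (γ : Fin r → F)
    (s : Finset F) (hs : ∀ x ∈ s, A.polarForm u v γ x = 0) :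
    s.card ≤ 2 ^ (2 * r) * (2 ^ e * 2 ^ (e - 1)) := by
  classical
  have huv' : u + v ≠ 0 := by rwa [← CharTwo.sub_eq_add, sub_ne_zero]
  have hlam : 1 + A.lam ^ 2 ≠ 0 := by
    rw [← one_pow 2, ← CharTwo.add_sq, ← CharTwo.sub_eq_add]
    exact pow_ne_zero _ (sub_ne_zero.mpr A.lam_ne_one.symm)
  let φ : F → F × F := fun x => (relTrace e m (u * x), relTrace e m ((u + v) * x))
  let S₁ : Finset F := Finset.univ.filter fun a => a ^ 2 ^ e = a
  -- By transitivity of the trace, the radical condition Tr((u+v)x) = 0 places the second coordinate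
  -- in the kernel of the trace polynomial of degree 2^(e-1).
  let S₂ : Finset F := Finset.univ.filter fun a => ∑ i ∈ Finset.range e, a ^ 2 ^ i = 0
  have hS₁ : S₁.card ≤ 2 ^ e := by
    refine card_le_of_linearized (ι := Bool) (fun b => if b then e else 0) ?_ e ?_
      (fun b => if b then 1 else -1) true (by simp) 0 S₁ ?_
    · rintro (_ | _) (_ | _) h <;> simp at h ⊢ <;> omega
    · rintro (_ | _) <;> simp
    · intro x hx
      have hx' : x ^ 2 ^ e = x := by simpa [S₁] using hx
      simp [hx']
  have hS₂ : S₂.card ≤ 2 ^ (e - 1) := by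
    refine card_le_of_linearized (ι := Fin e) (fun i => i) Fin.val_injective (e - 1)
      (fun i => by omega) (fun _ => 1) ⟨0, he⟩ one_ne_zero 0 S₂ fun x hx => ?_
    have hx' : ∑ i ∈ Finset.range e, x ^ 2 ^ i = 0 := by simpa [S₂] using hx
    rw [Finset.sum_range] at hx'
    simpa using hx'
  have himage : s.image φ ⊆ S₁ ×ˢ S₂ := by
    intro p hp
    obtain ⟨x, hx, rfl⟩ := Finset.mem_image.mp hp
    have htr := A.trace_eq_zero_of_polarForm hr u v γ (hs x hx)
    have hn : ∀ x : F, x ^ 2 ^ (e * m) = x := A.deg_eq ▸ A.pow_card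
    simp only [φ, S₁, S₂, Finset.mem_product, Finset.mem_filter, Finset.mem_univ, true_and,
      relTrace_pow e m hn, sum_relTrace_pow]
    rw [← A.deg_eq, ← algebraMap_trace_eq A.card_eq, htr, map_zero]
  have hfiber : ∀ p ∈ s.image φ, (s.filter fun x => φ x = p).card ≤ 2 ^ (2 * r) := by
    rintro ⟨a, b⟩ -
    refine card_le_of_polarPoly A.pow_card hr γ ((u + v) ^ 2 * (1 + A.lam ^ 2))
      (Or.inl (mul_ne_zero (pow_ne_zero _ huv') hlam)) (A.lam ^ 2 * (u * a + v * (a + b))) _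
      fun x hx => ?_
    obtain ⟨hxs, hx⟩ := Finset.mem_filter.mp hx
    simp only [φ, Prod.mk.injEq, add_mul, relTrace_add] at hx
    have h0 := A.polarMap_eq_zero _ _ _ (hs x hxs)
    have hv : relTrace e m (v * x) = a + b := by
      rw [← hx.2, hx.1, ← add_assoc, CharTwo.add_self_eq_zero, zero_add]
    rwa [polarMap, hx.1, hv, CharTwo.add_eq_zero] at h0
  calc s.card ≤ 2 ^ (2 * r) * (s.image φ).card := Finset.card_le_mul_card_image s _ hfiber
    _ ≤ 2 ^ (2 * r) * (S₁ ×ˢ S₂).card := Nat.mul_le_mul_left _ (Finset.card_le_card himage)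
    _ ≤ 2 ^ (2 * r) * (2 ^ e * 2 ^ (e - 1)) := by
      rw [Finset.card_product]
      gcongr

lemma norm_sum_corrForm_sq_le (he : 0 < e) (hr : r ≤ n) (χ : AddChar (ZMod 4) ℂ) (hχ : χ 2 ≠ 1)
    (u v g : F) (γ : Fin r → F) (h : ¬(u = v ∧ g = 0 ∧ γ = 0)) :
    ‖∑ x, χ (A.corrForm u v g γ x)‖ ^ 2 ≤ 2 ^ n * (2 ^ (2 * r) * (2 ^ e * 2 ^ (e - 1))) := by
  classical
  have key : ∀ N : ℕ, (∀ s : Finset F, (∀ x ∈ s, A.polarForm u v γ x = 0) → s.card ≤ N) →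
      ‖∑ x, χ (A.corrForm u v g γ x)‖ ^ 2 ≤ 2 ^ n * N := by
    intro N hN
    refine (norm_sum_addChar_sq_le χ hχ (A.corrForm u v g γ) (A.polarForm u v γ)
      (A.corrForm_add hr u v g γ) (Finset.univ.filter fun x => A.polarForm u v γ x = 0)
      (by simp)).trans ?_
    rw [A.card_eq]
    push_cast
    refine mul_le_mul_of_nonneg_left ?_ (by positivity)
    exact_mod_cast hN _ (by simp)
  by_cases huv : u = v
  · subst huv
    by_cases hγ : γ = 0
    · subst hγ
      -- Here the radical is the whole field and gives no useful bound, but the form reduces to 2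
      -- Tr(gx) with g ≠ 0, so the sum vanishes.
      have hg : g ≠ 0 := fun hg => h ⟨rfl, hg, rfl⟩
      let ψ : AddChar F ℂ := χ.compAddMonoidHom
        (twice.comp ((Algebra.trace (ZMod 2) F).toAddMonoidHom.comp (AddMonoidHom.mulLeft g)))
      have hψ : ∀ x, χ (A.corrForm u u g (0 : Fin r → F) x) = ψ x := by
        intro x
        simp [corrForm, ψ, add_assoc, CharTwo.add_self_eq_zero]
      have hne : ψ ≠ 0 := by
        intro h0
        refine hg (eq_zero_of_trace_mul_eq_zero _ fun w => ?_)
        by_contra hw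
        have hall : ∀ r : ZMod 2, r ≠ 0 → r = 1 := by decide
        have h1 := DFunLike.congr_fun h0 w
        have h2 : ψ w = χ (twice (Algebra.trace (ZMod 2) F (w * g))) := by
          rw [mul_comm w g]; rfl
        rw [h2, hall _ hw] at h1
        exact hχ h1
      simp_rw [hψ]
      rw [AddChar.sum_eq_zero_iff_ne_zero.mpr hne, norm_zero]
      rw [zero_pow two_ne_zero]
      positivity
    · refine (key _ (A.card_radical_le_of_eq hr u γ hγ)).trans ?_
      push_cast
      refine mul_le_mul_of_nonneg_left (le_mul_of_one_le_right (by positivity) ?_) (by positivity)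
      exact one_le_mul_of_one_le_of_one_le (one_le_pow₀ one_le_two) (one_le_pow₀ one_le_two)
  · refine (key _ (A.card_radical_le_of_ne he hr huv γ)).trans (le_of_eq ?_)
    push_cast
    rfl

/-- Reduction modulo 2 forces u = v. A nonzero γ would then bound the radical, which is the whole
field, by 2^(2r) < 2^n. What remains is 2 Tr(gx), and the trace form is nondegenerate. -/
lemma eq_zero_of_corrForm_eq_zero (hr : 2 * r < n) (u v g : F) (γ : Fin r → F)
    (h : ∀ x, A.corrForm u v g γ x = 0) : u = v ∧ g = 0 ∧ γ = 0 := by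
  have huv : u = v := by
    have : u + v = 0 := eq_zero_of_trace_mul_eq_zero _ fun w => by
      rw [mul_comm, ← A.red_corrForm u v g γ, h, map_zero]
    rwa [CharTwo.add_eq_zero] at this
  subst huv
  have hγ : γ = 0 := by
    by_contra hγ
    have := A.card_radical_le_of_eq (by omega) u γ hγ Finset.univ fun x _ => by
      ext y
      have h1 := A.corrForm_add (by omega) u u g γ x y
      rw [h, h, h, zero_add, zero_add] at h1
      exact twice_injective (h1.symm.trans (map_zero _).symm)
    rw [Finset.card_univ, A.card_eq] at this
    exact absurd ((Nat.pow_le_pow_iff_right (by norm_num)).mp this) (by omega)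
  refine ⟨rfl, ?_, hγ⟩
  subst hγ
  refine eq_zero_of_trace_mul_eq_zero _ fun w => twice_injective ?_
  have := h w
  simp only [corrForm, sub_self, Pi.zero_apply, zero_mul, map_zero, Finset.sum_const_zero,
    add_zero, zero_add, add_assoc, CharTwo.add_self_eq_zero] at this
  rw [mul_comm, this, map_zero]

end TraceForms
end FiniteField

/-! ### Teichmüller lifts, Frobenius and traces in the Galois ring -/

section GaloisRing

variable {f : (ZMod 4)[X]} {n : ℕ}

lemma proj_surjective (f : (ZMod 4)[X]) : Function.Surjective (proj f) := by
  intro a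
  obtain ⟨p, rfl⟩ := AdjoinRoot.mk_surjective a
  obtain ⟨q, rfl⟩ := Polynomial.map_surjective red (ZMod.castHom_surjective _) p
  exact ⟨AdjoinRoot.mk f q, proj_mk f q⟩

lemma proj_algebraMap (f : (ZMod 4)[X]) (a : ZMod 4) :
    proj f (algebraMap (ZMod 4) (GR f) a) = algebraMap (ZMod 2) (ResField f) (red a) := by
  have h := proj_mk f (C a)
  rwa [map_C] at h

lemma proj_two (f : (ZMod 4)[X]) : proj f 2 = 0 := by
  have h := proj_algebraMap f 2
  rwa [map_ofNat, show red 2 = 0 from rfl, map_zero] at h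

/-- An element of the kernel is even, a = 2b; then the image of b is killed by 2, so b is even too
and a is a multiple of 4. -/
lemma algebraMap_GR_injective [Fact (Irreducible (f.map red))] (hf : f.Monic) :
    Function.Injective (algebraMap (ZMod 4) (GR f)) := by
  have hred : ∀ a y, algebraMap (ZMod 4) (GR f) a = 2 * y → ∃ b, a = 2 * b := by
    intro a y h
    have h1 := congrArg (proj f) h
    rw [proj_algebraMap, map_mul, proj_two, zero_mul] at h1
    exact red_ker a ((map_eq_zero _).mp h1)
  rw [injective_iff_map_eq_zero]
  intro a ha
  obtain ⟨b, rfl⟩ := hred a 0 (by rw [ha, mul_zero])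
  rw [map_mul, map_ofNat] at ha
  obtain ⟨y, hy⟩ := two_mul_eq_zero f hf _ ha
  obtain ⟨c, rfl⟩ := hred b y hy
  rw [← mul_assoc, show (2 * 2 : ZMod 4) = 0 by decide, zero_mul]

lemma two_mul_eq_of_proj_eq {x y : GR f} (h : proj f x = proj f y) : 2 * x = 2 * y := by
  obtain ⟨w, hw⟩ := proj_ker f (x - y) (by rw [map_sub, h, sub_self])
  linear_combination 2 * hw + w * four_eq_zero f

lemma two_mul_eq_algebraMap_twice {x : GR f} {r : ZMod 2}
    (h : proj f x = algebraMap (ZMod 2) (ResField f) r) :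
    2 * x = algebraMap (ZMod 4) (GR f) (twice r) := by
  obtain ⟨a, rfl⟩ := ZMod.castHom_surjective (by norm_num : 2 ∣ 4) r
  change proj f x = algebraMap (ZMod 2) (ResField f) (red a) at h
  change _ = algebraMap (ZMod 4) (GR f) (twice (red a))
  rw [← proj_algebraMap] at h
  rw [two_mul_eq_of_proj_eq h, twice_red, map_mul, map_ofNat]

/-- The Teichmüller lift from the residue field to `G_C ∪ {0}`. -/
def teich (f : (ZMod 4)[X]) (n : ℕ) (a : ResField f) : GR f :=
  Function.surjInv (proj_surjective f) a ^ 2 ^ n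

lemma proj_teich (hf : IsBasicPrimitive f n) (a : ResField f) : proj f (teich f n a) = a := by
  rw [teich, map_pow, Function.surjInv_eq (proj_surjective f), resField_pow f n hf]

lemma pow_eq_pow_of_proj_eq (hf : IsBasicPrimitive f n) {x y : GR f} (h : proj f x = proj f y) :
    x ^ 2 ^ n = y ^ 2 ^ n := by
  obtain ⟨w, hw⟩ := proj_ker f (x - y) (by rw [map_sub, h, sub_self])
  rw [show x = y + 2 * w by rw [← hw]; ring, pow_add_two_mul f n (degree_pos f n hf)]

lemma teich_proj (hf : IsBasicPrimitive f n) {x : GR f} (hx : x ∈ GC₀ f n) :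
    teich f n (proj f x) = x := by
  rw [mem_GC₀_iff f n hf] at hx
  conv_rhs => rw [← hx]
  exact pow_eq_pow_of_proj_eq hf (Function.surjInv_eq _ _)

lemma teich_mem (hf : IsBasicPrimitive f n) (a : ResField f) : teich f n a ∈ GC₀ f n := by
  rw [mem_GC₀_iff f n hf]
  exact pow_eq_pow_of_proj_eq hf ((proj_teich hf a).trans (Function.surjInv_eq _ _).symm)

lemma teich_mul (hf : IsBasicPrimitive f n) (a b : ResField f) :
    teich f n (a * b) = teich f n a * teich f n b := by
  rw [teich, teich, teich, ← mul_pow]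
  exact pow_eq_pow_of_proj_eq hf (by simp only [map_mul, Function.surjInv_eq])

lemma teich_one (hf : IsBasicPrimitive f n) : teich f n 1 = 1 := by
  rw [← map_one (proj f), teich_proj hf]
  rw [mem_GC₀_iff f n hf, one_pow]

lemma teich_zero (hf : IsBasicPrimitive f n) : teich f n 0 = 0 := by
  rw [← map_zero (proj f), teich_proj hf]
  exact Or.inl rfl

lemma teich_pow (hf : IsBasicPrimitive f n) (a : ResField f) (k : ℕ) :
    teich f n (a ^ k) = teich f n a ^ k := by
  induction k with
  | zero => rw [pow_zero, pow_zero, teich_one hf]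
  | succ k ih => rw [pow_succ, pow_succ, teich_mul hf, ih]

/-- The lift of a + b differs from the sum of the lifts by some 2w, which squaring kills because 4 =
0. Only the cross term 2ab survives; it is the source of the quadratic form. -/
lemma teich_sq_add_sq (hf : IsBasicPrimitive f n) (a b : ResField f) :
    teich f n ((a + b) ^ 2) = teich f n (a ^ 2) + teich f n (b ^ 2) + 2 * teich f n (a * b) := by
  obtain ⟨w, hw⟩ := proj_ker f (teich f n (a + b) - (teich f n a + teich f n b)) (by
    simp only [map_sub, map_add, proj_teich hf, sub_self])
  rw [teich_pow hf, teich_pow hf, teich_pow hf, teich_mul hf]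
  linear_combination (teich f n (a + b) + (teich f n a + teich f n b)) * hw +
    (w * (teich f n a + teich f n b + w)) * four_eq_zero f + 2 * w * hw

lemma exists_eq_teich_add (hf : IsBasicPrimitive f n) (x : GR f) :
    ∃ a b, x = teich f n a + 2 * teich f n b := by
  obtain ⟨h1, h2, h3⟩ := twoAdic_spec f n hf x
  exact ⟨proj f (twoAdic f n x).1, proj f (twoAdic f n x).2, by
    rw [teich_proj hf h1, teich_proj hf h2, ← h3]⟩

lemma frob_teich_add (hf : IsBasicPrimitive f n) (d : ℕ) (a b : ResField f) :
    frob f n d (teich f n a + 2 * teich f n b) =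
      teich f n (a ^ 2 ^ d) + 2 * teich f n (b ^ 2 ^ d) := by
  have h := (existsUnique_twoAdic f n hf (teich f n a + 2 * teich f n b)).unique
    (twoAdic_spec f n hf _) (y₂ := (teich f n a, teich f n b)) ⟨teich_mem hf a, teich_mem hf b, rfl⟩
  rw [frob, h, teich_pow hf, teich_pow hf]

lemma frob_iterate_teich_add (hf : IsBasicPrimitive f n) (i : ℕ) (a b : ResField f) :
    (frob f n 1)^[i] (teich f n a + 2 * teich f n b) =
      teich f n (a ^ 2 ^ i) + 2 * teich f n (b ^ 2 ^ i) := by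
  induction i with
  | zero => simp
  | succ i ih =>
    rw [Function.iterate_succ_apply', ih, frob_teich_add hf, ← pow_mul, ← pow_mul, pow_one,
      ← pow_succ]

lemma two_mul_teich_add (hf : IsBasicPrimitive f n) (a b : ResField f) :
    2 * teich f n (a + b) = 2 * teich f n a + 2 * teich f n b := by
  rw [← mul_add]
  exact two_mul_eq_of_proj_eq (by simp only [map_add, proj_teich hf])

lemma proj_frob (hf : IsBasicPrimitive f n) (d : ℕ) (x : GR f) :
    proj f (frob f n d x) = proj f x ^ 2 ^ d := by
  obtain ⟨a, b, rfl⟩ := exists_eq_teich_add hf x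
  have h2 : ∀ y, proj f (2 * y) = 0 := fun y => by
    rw [map_mul, proj_two, zero_mul]
  rw [frob_teich_add hf, map_add, map_add, h2, h2, proj_teich hf, proj_teich hf, add_zero, add_zero]

/-- The sum `∑_{i<n} t^(2^i)` of the conjugates of the Teichmüller lift `t` of `a`. -/
def conjSum (f : (ZMod 4)[X]) (n : ℕ) (a : ResField f) : GR f :=
  ∑ i ∈ Finset.range n, teich f n (a ^ 2 ^ i)

lemma trace_teich_add (hf : IsBasicPrimitive f n) (a b : ResField f) :
    trace f n 1 n (teich f n a + 2 * teich f n b) = conjSum f n a + 2 * conjSum f n b := by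
  simp only [trace, Nat.div_one, frob_iterate_teich_add hf, conjSum, Finset.sum_add_distrib,
    Finset.mul_sum]

instance [Fact (Irreducible (f.map red))] : CharP (ResField f) 2 :=
  charP_of_injective_algebraMap (algebraMap (ZMod 2) (ResField f)).injective 2

variable [Fact (Irreducible (f.map red))]

/-- Frobenius acts on 2-adic components, which do not add independently. The carry for a² + c² is
ac; Frobenius squares it, giving the carry for a⁴ + c⁴. Every residue is a square, so this covers
all cases. -/
lemma frob_one_add (hf : IsBasicPrimitive f n) (x y : GR f) :
    frob f n 1 (x + y) = frob f n 1 x + frob f n 1 y := by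
  obtain ⟨a, b, rfl⟩ := exists_eq_teich_add hf x
  obtain ⟨c, d, rfl⟩ := exists_eq_teich_add hf y
  have hsq : ∀ a : ResField f, ∃ b, a = b ^ 2 := fun a => ⟨a ^ 2 ^ (n - 1), by
    rw [← pow_mul, ← pow_succ, Nat.sub_add_cancel (degree_pos f n hf), resField_pow f n hf]⟩
  obtain ⟨a, rfl⟩ := hsq a
  obtain ⟨c, rfl⟩ := hsq c
  have h1 := teich_sq_add_sq hf a c
  have h2 := teich_sq_add_sq hf (a ^ 2) (c ^ 2)
  rw [CharTwo.add_sq] at h1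
  have h3 : teich f n (a ^ 2) + 2 * teich f n b + (teich f n (c ^ 2) + 2 * teich f n d) =
      teich f n (a ^ 2 + c ^ 2) + 2 * teich f n (b + d + a * c) := by
    rw [two_mul_teich_add hf, two_mul_teich_add hf]
    linear_combination -h1 - teich f n (a * c) * four_eq_zero f
  rw [h3, frob_teich_add hf, frob_teich_add hf, frob_teich_add hf, pow_one, h2, CharTwo.add_sq,
    CharTwo.add_sq, two_mul_teich_add hf, two_mul_teich_add hf, mul_pow]
  linear_combination teich f n (a ^ 2 * c ^ 2) * four_eq_zero f

/-- By uniqueness of the 2-adic representation both components are fixed by squaring, so their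
residues are 0 or 1. -/
lemma exists_algebraMap_eq_of_frob_eq (hf : IsBasicPrimitive f n) {x : GR f} (hx : frob f n 1 x = x) :
    ∃ z, algebraMap (ZMod 4) (GR f) z = x := by
  obtain ⟨a, b, rfl⟩ := exists_eq_teich_add hf x
  rw [frob_teich_add hf] at hx
  have h := (existsUnique_twoAdic f n hf (teich f n a + 2 * teich f n b)).unique
    (y₁ := (teich f n (a ^ 2 ^ 1), teich f n (b ^ 2 ^ 1))) (y₂ := (teich f n a, teich f n b))
    ⟨teich_mem hf _, teich_mem hf _, hx.symm⟩ ⟨teich_mem hf a, teich_mem hf b, rfl⟩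
  have key : ∀ a : ResField f, teich f n (a ^ 2 ^ 1) = teich f n a →
      ∃ z, algebraMap (ZMod 4) (GR f) z = teich f n a := by
    intro a ha
    have h1 := congrArg (proj f) ha
    rw [proj_teich hf, proj_teich hf, pow_one, sq] at h1
    rcases IsIdempotentElem.iff_eq_zero_or_one.mp h1 with rfl | rfl
    · exact ⟨0, by rw [teich_zero hf, map_zero]⟩
    · exact ⟨1, by rw [teich_one hf, map_one]⟩
  obtain ⟨z, hz⟩ := key a (congrArg Prod.fst h)
  obtain ⟨w, hw⟩ := key b (congrArg Prod.snd h)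
  exact ⟨z + 2 * w, by rw [map_add, map_mul, hz, hw, map_ofNat]⟩

lemma frob_zero (hf : IsBasicPrimitive f n) (d : ℕ) : frob f n d 0 = 0 := by
  have h := frob_teich_add hf d 0 0
  rwa [zero_pow (by positivity), teich_zero hf, mul_zero, add_zero] at h

lemma frob_conjSum (hf : IsBasicPrimitive f n) (a : ResField f) :
    frob f n 1 (conjSum f n a) = conjSum f n a := by
  let φ : GR f →+ GR f := ⟨⟨frob f n 1, frob_zero hf 1⟩, frob_one_add hf⟩
  have h : φ (conjSum f n a) = ∑ i ∈ Finset.range n, teich f n ((a ^ 2) ^ 2 ^ i) := by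
    rw [conjSum, map_sum]
    refine Finset.sum_congr rfl fun i _ => ?_
    have h := frob_teich_add hf 1 (a ^ 2 ^ i) 0
    rw [teich_zero hf, mul_zero, add_zero, zero_pow (by positivity), teich_zero hf, mul_zero,
      add_zero, pow_one, pow_right_comm] at h
    exact h
  exact h.trans (sum_pow_succ_eq (teich f n) (resField_pow f n hf a))

lemma conjSum_add (hf : IsBasicPrimitive f n) (a b : ResField f) :
    conjSum f n (a + b) = conjSum f n a + conjSum f n b + 2 * conjSum f n (a * b) := by
  have hn := resField_pow f n hf
  rw [conjSum, conjSum, conjSum, conjSum, ← sum_pow_succ_eq (teich f n) (hn (a + b)),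
    ← sum_pow_succ_eq (teich f n) (hn a), ← sum_pow_succ_eq (teich f n) (hn b), Finset.mul_sum,
    ← Finset.sum_add_distrib, ← Finset.sum_add_distrib]
  refine Finset.sum_congr rfl fun i _ => ?_
  rw [pow_right_comm, add_pow_two_pow, teich_sq_add_sq hf, mul_pow, pow_right_comm a,
    pow_right_comm b]

lemma proj_conjSum (hf : IsBasicPrimitive f n) (a : ResField f) :
    proj f (conjSum f n a) = absTrace n a := by
  simp only [conjSum, map_sum, proj_teich hf, absTrace]

lemma proj_trace (hf : IsBasicPrimitive f n) (k : ℕ) (x : GR f) :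
    proj f (trace f n 1 k x) = absTrace k (proj f x) := by
  rw [trace, Nat.div_one, map_sum, absTrace]
  refine Finset.sum_congr rfl fun i hi => ?_
  clear hi
  induction i generalizing x with
  | zero => simp
  | succ i ih => rw [Function.iterate_succ_apply, ih, proj_frob hf, pow_one, ← pow_mul, ← pow_succ']

lemma proj_P {e m : ℕ} (hf : IsBasicPrimitive f (e * m)) (x : GR f) :
    proj f (P f e m x) = altSum e m (proj f x) := by
  rw [P, altSum]
  split_ifs <;> simp only [map_add, map_sum, proj_trace hf, map_pow]

variable [Fintype (ResField f)]

lemma card_resField (hf : IsBasicPrimitive f n) : Fintype.card (ResField f) = 2 ^ n := by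
  have hne : f.map red ≠ 0 := hf.2.2.1.ne_zero
  have : Module.Finite (ZMod 2) (ResField f) := (AdjoinRoot.powerBasis hne).finite
  rw [Module.card_eq_pow_finrank (K := ZMod 2), (AdjoinRoot.powerBasis hne).finrank, ZMod.card,
    AdjoinRoot.powerBasis_dim, hf.2.2.2.1]

/-- Frobenius invariance of `conjSum` makes it ℤ/4-valued, and idempotence of `altSum` makes it
ℤ/2-valued; the polarization identities then descend by injectivity of the algebra maps. -/
lemma exists_traceForms {e m : ℕ} (hm : 0 < m) (hf : IsBasicPrimitive f (e * m)) {lam : GR f}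
    (hlam : lam ∈ subGR f (e * m) e) (hlam1 : proj f lam ≠ 1) :
    ∃ A : TraceForms (ResField f) (e * m) e m, A.lam = proj f lam ∧
      (∀ a, algebraMap (ZMod 4) (GR f) (A.quad a) = conjSum f (e * m) a) ∧
      ∀ x, algebraMap (ZMod 2) (ResField f) (A.alt (proj f x)) = proj f (P f e m x) := by
  have hinj := algebraMap_GR_injective hf.1
  have hinj2 := (algebraMap (ZMod 2) (ResField f)).injective
  have hcard := card_resField hf
  have hn := resField_pow f (e * m) hf
  choose Q hQ using fun a => exists_algebraMap_eq_of_frob_eq hf (frob_conjSum hf a)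
  have hR : ∀ x : ResField f, ∃ r, algebraMap (ZMod 2) (ResField f) r = altSum e m x := by
    intro x
    have h := altSum_sq hn x
    rw [sq] at h
    rcases IsIdempotentElem.iff_eq_zero_or_one.mp h with h | h
    · exact ⟨0, by rw [h, map_zero]⟩
    · exact ⟨1, by rw [h, map_one]⟩
  choose R hR using hR
  have htr : ∀ x, algebraMap (ZMod 2) (ResField f) (Algebra.trace (ZMod 2) (ResField f) x) =
      absTrace (e * m) x := algebraMap_trace_eq hcard
  refine ⟨⟨hcard, rfl, Q, ?_, ?_, R, ?_, proj f lam, ?_, hlam1⟩, rfl, hQ, ?_⟩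
  · intro x y
    apply hinj
    rw [map_add, map_add, hQ, hQ, hQ, conjSum_add hf,
      ← two_mul_eq_algebraMap_twice ((proj_conjSum hf (x * y)).trans (htr _).symm)]
  · intro x
    apply hinj2
    rw [← proj_algebraMap, hQ, proj_conjSum hf, htr]
  · intro x y
    apply hinj2
    rw [map_add, map_add, hR, hR, hR, htr, altSum_add hm hn]
  · have h : frob f (e * m) e lam = lam := hlam
    rw [← proj_frob hf, h]
  · intro x
    rw [proj_P hf]
    exact hR _

lemma seqValue_teich {e m ρ : ℕ} (hf : IsBasicPrimitive f (e * m)) {lam : GR f}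
    (A : TraceForms (ResField f) (e * m) e m) (hlam : A.lam = proj f lam)
    (hquad : ∀ a, algebraMap (ZMod 4) (GR f) (A.quad a) = conjSum f (e * m) a)
    (halt : ∀ x, algebraMap (ZMod 2) (ResField f) (A.alt (proj f x)) = proj f (P f e m x))
    {c₀ : GR f} (hc₀ : c₀ ∈ GC₀ f (e * m)) (c : Fin (ρ - 1) → GR f) (x : ResField f) :
    seqValue f e m ρ lam c₀ c (teich f (e * m) x) =
      algebraMap (ZMod 4) (GR f) (A.seqForm 1 (proj f c₀) (fun k => proj f (c k)) x) := by
  have htr : ∀ x, absTrace (e * m) x =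
      algebraMap (ZMod 2) (ResField f) (Algebra.trace (ZMod 2) (ResField f) x) :=
    fun x => (algebraMap_trace_eq (card_resField hf) x).symm
  have h1 : (1 + 2 * c₀) * teich f (e * m) x =
      teich f (e * m) x + 2 * teich f (e * m) (proj f c₀ * x) := by
    rw [teich_mul hf, teich_proj hf hc₀]
    ring
  rw [seqValue, h1, trace_teich_add hf, TraceForms.seqForm, map_add, map_add, map_add, map_add,
    map_add, hquad, one_mul]
  rw [two_mul_eq_algebraMap_twice ((proj_conjSum hf _).trans (htr _)),
    two_mul_eq_algebraMap_twice (x := P f e m _)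
      (r := A.alt (proj f (lam * teich f (e * m) x))) (halt _).symm,
    two_mul_eq_algebraMap_twice (r := ∑ k, Algebra.trace (ZMod 2) (ResField f)
      (proj f (c k) * x ^ (1 + 2 ^ ((k : ℕ) + 1))))
      (by simp only [map_sum, proj_trace hf, map_mul, map_pow, proj_teich hf, htr]),
    map_mul (proj f), proj_teich hf, hlam]
  ring

lemma two_mul_trace_teich {e m r : ℕ} (hf : IsBasicPrimitive f (e * m))
    (A : TraceForms (ResField f) (e * m) e m) (x : ResField f) :
    2 * trace f (e * m) 1 (e * m) (teich f (e * m) x) =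
      algebraMap (ZMod 4) (GR f) (A.seqForm 0 1 (0 : Fin r → ResField f) x) := by
  have h : A.seqForm 0 1 (0 : Fin r → ResField f) x =
      twice (Algebra.trace (ZMod 2) (ResField f) x) := by
    simp [TraceForms.seqForm, A.quad_zero, A.alt_zero]
  rw [h]
  refine two_mul_eq_algebraMap_twice ?_
  rw [proj_trace hf, proj_teich hf]
  exact (algebraMap_trace_eq (card_resField hf) x).symm

end GaloisRing

/-! ### Shifts, periods and correlations of the sequences of form values -/

namespace TraceForms

variable {F : Type*} [Field F] [Fintype F] [Algebra (ZMod 2) F]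
variable {n e m r : ℕ} (A : TraceForms F n e m)

/-- The coefficients `(u, g, γ)` of a member of the family in `seqForm`. -/
def coeffs : Option (F × (Fin r → F)) → F × F × (Fin r → F)
  | none => (0, 1, 0)
  | some (g, γ) => (1, g, γ)

/-- The members of the family, as sequences of values of `seqForm` at the powers of `b`. -/
def sequence (b : Fˣ) (p : Option (F × (Fin r → F))) (t : ℕ) : ZMod 4 :=
  A.seqForm (coeffs p).1 (coeffs p).2.1 (coeffs p).2.2 ((b : F) ^ t)

/-- The quadratic form whose exponential sum is a correlation of two members of the family. -/
def shiftForm (p p' : Option (F × (Fin r → F))) (y : F) : F → ZMod 4 :=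
  A.corrForm (coeffs p).1 ((coeffs p').1 * y) ((coeffs p).2.1 + (coeffs p').2.1 * y)
    (fun k => (coeffs p).2.2 k + (coeffs p').2.2 k * y ^ (1 + 2 ^ ((k : ℕ) + 1)))

lemma sequence_sub (b : Fˣ) (p p' : Option (F × (Fin r → F))) (t τ : ℕ) :
    A.sequence b p t - A.sequence b p' (t + τ) = A.shiftForm p p' ((b : F) ^ τ) ((b : F) ^ t) := by
  rw [sequence, sequence, add_comm t, pow_add, seqForm_sub, shiftForm]

/-- The coefficient u is 0 for the exceptional sequence and 1 otherwise, which separates the two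
kinds. The shift y = 1 is then read off from g in the exceptional case and from u in the other. -/
lemma eq_of_coeffs_eq {K : Type*} [Field K] [CharP K 2] {p p' : Option (K × (Fin r → K))} {y : K}
    (hy : y ≠ 0)
    (h : (coeffs p).1 = (coeffs p').1 * y ∧ (coeffs p).2.1 + (coeffs p').2.1 * y = 0 ∧
      (fun k => (coeffs p).2.2 k + (coeffs p').2.2 k * y ^ (1 + 2 ^ ((k : ℕ) + 1))) = 0) :
    p = p' ∧ y = 1 := by
  obtain ⟨h1, h2, h3⟩ := h
  rcases p with _ | ⟨g, γ⟩ <;> rcases p' with _ | ⟨g', γ'⟩ <;> simp only [coeffs] at h1 h2 h3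
  · rw [one_mul, CharTwo.add_eq_zero] at h2
    exact ⟨rfl, h2.symm⟩
  · rw [one_mul] at h1
    exact absurd h1.symm hy
  · rw [zero_mul] at h1
    exact absurd h1 one_ne_zero
  · rw [one_mul] at h1
    subst h1
    rw [mul_one, CharTwo.add_eq_zero] at h2
    have h4 : γ = γ' := by
      ext k
      have := congrFun h3 k
      simpa [CharTwo.add_eq_zero] using this
    rw [h2, h4]
    exact ⟨rfl, rfl⟩

variable {b : Fˣ} (hb : ∀ x, x ∈ Subgroup.zpowers b)
include A hb

lemma orderOf_generator : orderOf b = 2 ^ n - 1 := by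
  classical
  rw [orderOf_eq_card_of_forall_mem_zpowers hb, Nat.card_eq_fintype_card, Fintype.card_units,
    A.card_eq]

/-- Powers of the generator exhaust the nonzero elements; the missing point 0 is the origin of the
summand 1 in the correlation bound. -/
lemma sum_powers {M : Type*} [AddCommGroup M] (g : F → M) :
    ∑ t ∈ Finset.range (2 ^ n - 1), g ((b : F) ^ t) = ∑ x, g x - g 0 := by
  classical
  rw [Fintype.sum_eq_add_sum_compl 0, add_sub_cancel_left, ← A.orderOf_generator hb]
  refine Finset.sum_bij (fun t _ => (b : F) ^ t) (fun t _ => by simp) ?_ ?_ (fun _ _ => rfl)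
  · intro s hs t ht hst
    rw [Finset.mem_range] at hs ht
    exact pow_injOn_Iio_orderOf hs ht (Units.ext (by simpa using hst))
  · intro x hx
    have hx0 : x ≠ 0 := by simpa using hx
    have h := (mem_powers_iff_mem_range_orderOf (x := b) (y := Units.mk0 x hx0)).mp
      (mem_powers_iff_mem_zpowers.mpr (hb _))
    obtain ⟨t, ht, h⟩ := Finset.mem_image.mp h
    exact ⟨t, ht, by rw [← Units.val_pow_eq_pow_val, h, Units.val_mk0]⟩

lemma sequence_add_of_dvd (p : Option (F × (Fin r → F))) {τ : ℕ} (h : 2 ^ n - 1 ∣ τ) (t : ℕ) :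
    A.sequence b p (t + τ) = A.sequence b p t := by
  rw [← A.orderOf_generator hb, orderOf_dvd_iff_pow_eq_one] at h
  have h' : (b : F) ^ τ = 1 := by rw [← Units.val_pow_eq_pow_val, h, Units.val_one]
  rw [sequence, sequence, pow_add, h', mul_one]

variable [CharP F 2]

/-- The difference form vanishes at 0 and at every power of the generator, hence identically, so its
coefficients are trivial. -/
lemma eq_of_sequence_shift (hr : 2 * r < n) {p p' : Option (F × (Fin r → F))} {τ : ℕ}
    (h : ∀ t, A.sequence b p t = A.sequence b p' (t + τ)) : p = p' ∧ 2 ^ n - 1 ∣ τ := by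
  have h1 := A.eq_zero_of_corrForm_eq_zero hr _ _ _ _ (fun x => by
    change A.shiftForm p p' ((b : F) ^ τ) x = 0
    by_cases hx : x = 0
    · rw [hx]
      exact A.corrForm_zero _ _ _ _
    · obtain ⟨t, ht⟩ := mem_powers_iff_mem_zpowers.mpr (hb (Units.mk0 x hx))
      have ht' : (b : F) ^ t = x := by
        have := congrArg Units.val ht
        simpa using this
      rw [← ht', ← sequence_sub, h, sub_self])
  obtain ⟨rfl, h2⟩ := eq_of_coeffs_eq (pow_ne_zero _ b.ne_zero) h1
  refine ⟨rfl, ?_⟩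
  rw [← A.orderOf_generator hb]
  exact orderOf_dvd_of_pow_eq_one (Units.ext (by simpa using h2))

lemma ncard_range_sequence (hr : 2 * r < n) :
    (Set.range (A.sequence b (r := r))).ncard = 2 ^ (n * (r + 1)) + 1 := by
  have hinj : Function.Injective (A.sequence b (r := r)) := fun p p' h =>
    (A.eq_of_sequence_shift hb hr (τ := 0) (fun t => congrFun h t)).1
  rw [← Set.image_univ, Set.ncard_image_of_injective _ hinj, Set.ncard_univ,
    Nat.card_eq_fintype_card, Fintype.card_option, Fintype.card_prod, Fintype.card_pi]
  simp only [A.card_eq, Finset.prod_const, Finset.card_univ, Fintype.card_fin]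
  ring

lemma cyclicallyDistinct_range_sequence (hr : 2 * r < n) :
    CyclicallyDistinct (Set.range (A.sequence b (r := r))) := by
  rintro _ ⟨p, rfl⟩ _ ⟨p', rfl⟩ τ h
  rw [(A.eq_of_sequence_shift hb hr h).1]

lemma hasLeastPeriod_sequence (hr : 2 * r < n) (p : Option (F × (Fin r → F))) :
    HasLeastPeriod (A.sequence b p) (2 ^ n - 1) := by
  refine ⟨⟨?_, fun t => A.sequence_add_of_dvd hb p dvd_rfl t⟩, ?_⟩
  · exact Nat.sub_pos_of_lt (Nat.one_lt_two_pow (by omega))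
  · rintro k ⟨hk, hper⟩
    exact Nat.le_of_dvd hk (A.eq_of_sequence_shift hb hr (p := p) fun t => (hper t).symm).2

lemma norm_correlation_lt (he : 0 < e) (hr : r ≤ n) {ω : ℂ} (hω : ω ^ 2 = -1)
    {p p' : Option (F × (Fin r → F))} {τ : ℕ} (hτ : τ < 2 ^ n - 1) (h : p ≠ p' ∨ τ ≠ 0) :
    ‖correlation ω (2 ^ n - 1) (A.sequence b p) (A.sequence b p') τ‖ <
      1 + (2 : ℝ) ^ (((n : ℝ) + 2 * (r : ℝ) + 2 * (e : ℝ)) / 2) := by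
  have hω4 : ω ^ 4 = 1 := by
    rw [show 4 = 2 * 2 by rfl, pow_mul, hω]; norm_num
  let χ : AddChar (ZMod 4) ℂ := AddChar.zmodChar 4 hω4
  have hχ2 : χ 2 ≠ 1 := by
    rw [AddChar.zmodChar_apply, show (2 : ZMod 4).val = 2 by rfl, hω]
    norm_num
  have hne : ¬((coeffs p).1 = (coeffs p').1 * (b : F) ^ τ ∧
      (coeffs p).2.1 + (coeffs p').2.1 * (b : F) ^ τ = 0 ∧
      (fun k => (coeffs p).2.2 k + (coeffs p').2.2 k * ((b : F) ^ τ) ^ (1 + 2 ^ ((k : ℕ) + 1))) =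
        0) := by
    intro h0
    obtain ⟨hp, h1⟩ := eq_of_coeffs_eq (pow_ne_zero _ b.ne_zero) h0
    have hdvd : orderOf b ∣ τ := orderOf_dvd_of_pow_eq_one (Units.ext (by simpa using h1))
    rw [A.orderOf_generator hb] at hdvd
    exact h.elim (fun h => h hp) fun h => h (Nat.eq_zero_of_dvd_of_lt hdvd hτ)
  have hcorr : correlation ω (2 ^ n - 1) (A.sequence b p) (A.sequence b p') τ =
      ∑ x, χ (A.shiftForm p p' ((b : F) ^ τ) x) - 1 := by
    have h0 : χ (A.shiftForm p p' ((b : F) ^ τ) 0) = 1 := by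
      rw [shiftForm, corrForm_zero, AddChar.map_zero_eq_one]
    rw [correlation, ← h0, ← A.sum_powers hb fun x => χ (A.shiftForm p p' ((b : F) ^ τ) x)]
    refine Finset.sum_congr rfl fun t _ => ?_
    rw [sequence_sub]
    rfl
  have hS := A.norm_sum_corrForm_sq_le he hr χ hχ2 _ _ _ _ hne
  change ‖∑ x, χ (A.shiftForm p p' ((b : F) ^ τ) x)‖ ^ 2 ≤ _ at hS
  set S := ∑ x, χ (A.shiftForm p p' ((b : F) ^ τ) x)
  have hlt : ‖S‖ < (2 : ℝ) ^ (((n : ℝ) + 2 * (r : ℝ) + 2 * (e : ℝ)) / 2) := by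
    refine lt_of_pow_lt_pow_left₀ 2 (by positivity) (hS.trans_lt ?_)
    rw [← Real.rpow_natCast (_ ^ _) 2, ← Real.rpow_mul (by norm_num), Nat.cast_ofNat,
      div_mul_cancel₀ _ (two_ne_zero),
      show (n : ℝ) + 2 * (r : ℝ) + 2 * (e : ℝ) = ((n + (2 * r + (e + e)) : ℕ) : ℝ) by
        push_cast; ring, Real.rpow_natCast, ← pow_add, ← pow_add, ← pow_add]
    -- Strictness comes from e + (e - 1) < e + e.
    exact pow_lt_pow_right₀ one_lt_two (by omega)
  rw [hcorr]
  calc ‖S - 1‖ ≤ ‖S‖ + ‖(1 : ℂ)‖ := norm_sub_le _ _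
    _ < 1 + _ := by rw [norm_one, add_comm]; gcongr

lemma exists_isGreatest_correlationMagnitudes (he : 0 < e) (hr : 2 * r < n) {ω : ℂ}
    (hω : ω ^ 2 = -1) : ∃ Rmax : ℝ,
      IsGreatest (correlationMagnitudes ω (2 ^ n - 1) (Set.range (A.sequence b (r := r)))) Rmax ∧
      Rmax < 1 + (2 : ℝ) ^ (((n : ℝ) + 2 * (r : ℝ) + 2 * (e : ℝ)) / 2) := by
  set R := correlationMagnitudes ω (2 ^ n - 1) (Set.range (A.sequence b (r := r)))
  have hfin : R.Finite := by
    refine Set.Finite.subset (Set.finite_range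
      fun q : (Option (F × (Fin r → F)) × Option (F × (Fin r → F))) × Fin (2 ^ n - 1) =>
        ‖correlation ω (2 ^ n - 1) (A.sequence b q.1.1) (A.sequence b q.1.2) q.2‖) ?_
    rintro _ ⟨_, ⟨p, rfl⟩, _, ⟨p', rfl⟩, τ, hτ, -, rfl⟩
    exact ⟨((p, p'), ⟨τ, hτ⟩), rfl⟩
  have hpos : 0 < 2 ^ n - 1 := Nat.sub_pos_of_lt (Nat.one_lt_two_pow (by omega))
  have hne : R.Nonempty := by
    refine ⟨_, A.sequence b none, ⟨_, rfl⟩, A.sequence b (some (0, 0)), ⟨_, rfl⟩, 0, hpos,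
      Or.inl fun h => ?_, rfl⟩
    have := (A.eq_of_sequence_shift hb hr (τ := 0) (fun t => congrFun h t)).1
    exact absurd this (by simp)
  refine ⟨sSup R, ⟨hne.csSup_mem hfin, fun x hx => le_csSup hfin.bddAbove hx⟩, ?_⟩
  obtain ⟨_, ⟨p, rfl⟩, _, ⟨p', rfl⟩, τ, hτ, h, hR⟩ := hne.csSup_mem hfin
  rw [hR]
  exact A.norm_correlation_lt hb he (by omega) hω hτ (h.imp_left fun h hp => h (by rw [hp]))

end TraceForms

/-! ### Passage from the Galois ring to the residue field, and the main theorem -/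

lemma familyL_eq_range {f : (ZMod 4)[X]} [Fact (Irreducible (f.map red))] [Fintype (ResField f)]
    {e m ρ : ℕ} (hf : IsBasicPrimitive f (e * m)) {lam : GR f}
    (A : TraceForms (ResField f) (e * m) e m) (hlam : A.lam = proj f lam)
    (hquad : ∀ a, algebraMap (ZMod 4) (GR f) (A.quad a) = conjSum f (e * m) a)
    (halt : ∀ x, algebraMap (ZMod 2) (ResField f) (A.alt (proj f x)) = proj f (P f e m x))
    {β : (GR f)ˣ} (hβ : β ∈ GC f (e * m)) :
    familyL f e m ρ lam β =
      Set.range (A.sequence (Units.map (proj f).toMonoidHom β) (r := ρ - 1)) := by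
  have hinj := algebraMap_GR_injective hf.1
  have hpow : ∀ t : ℕ, (β : GR f) ^ t = teich f (e * m)
      (((Units.map (proj f).toMonoidHom β : (ResField f)ˣ) : ResField f) ^ t) := by
    intro t
    rw [teich_pow hf]
    congr 1
    exact (teich_proj hf (Or.inr ⟨β, hβ, rfl⟩)).symm
  ext s
  constructor
  · rintro (⟨c₀, hc₀, c, -, h⟩ | h)
    · refine ⟨some (proj f c₀, fun k => proj f (c k)), funext fun t => hinj ?_⟩
      rw [h, hpow, seqValue_teich hf A hlam hquad halt hc₀]
      rfl
    · refine ⟨none, funext fun t => hinj ?_⟩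
      rw [h, hpow, two_mul_trace_teich hf A (r := ρ - 1)]
      rfl
  · rintro ⟨_ | ⟨g, γ⟩, rfl⟩
    · refine Or.inr fun t => ?_
      rw [hpow, two_mul_trace_teich hf A (r := ρ - 1)]
      rfl
    · refine Or.inl ⟨teich f _ g, teich_mem hf g, fun k => teich f _ (γ k),
        fun k => teich_mem hf _, fun t => ?_⟩
      rw [hpow, seqValue_teich hf A hlam hquad halt (teich_mem hf g)]
      simp only [proj_teich hf]
      rfl

/-- The Teichmüller lift of a nonzero residue lies in G_C, hence is a power of β; reduce it back. -/
lemma mem_zpowers_map_proj {f : (ZMod 4)[X]} [Fact (Irreducible (f.map red))] {n : ℕ}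
    (hf : IsBasicPrimitive f n) {β : (GR f)ˣ} (hβ : Subgroup.zpowers β = GC f n)
    (x : (ResField f)ˣ) : x ∈ Subgroup.zpowers (Units.map (proj f).toMonoidHom β) := by
  rcases teich_mem hf (x : ResField f) with h | ⟨u, hu, h⟩
  · have := proj_teich hf (x : ResField f)
    rw [h, map_zero] at this
    exact absurd this.symm x.ne_zero
  · rw [← hβ] at hu
    obtain ⟨k, rfl⟩ := hu
    refine ⟨k, ?_⟩
    ext
    simp only [← map_zpow]
    rw [← proj_teich hf (x : ResField f), ← h]
    rfl

end Quadriphase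

end

theorem theorem1 (n e m ρ : ℕ) (he : 2 ≤ e) (hm : 2 ≤ m) (hn : n = e * m)
    (hρ : 1 ≤ ρ) (hρn : ρ < n / 2)
    (f : Polynomial (ZMod 4)) (hf : Quadriphase.IsBasicPrimitive f n)
    (β : (Quadriphase.GR f)ˣ) (hβ : Subgroup.zpowers β = Quadriphase.GC f n)
    (lam : Quadriphase.GR f) (hlam : lam ∈ Quadriphase.subGR f n e)
    (hlam0 : Quadriphase.proj f lam ≠ 0) (hlam1 : Quadriphase.proj f lam ≠ 1)
    (ω : ℂ) (hω : ω ^ 2 = -1) :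
    (Quadriphase.familyL f e m ρ lam β).ncard = 2 ^ (n * ρ) + 1 ∧
    Quadriphase.CyclicallyDistinct (Quadriphase.familyL f e m ρ lam β) ∧
    (∀ s ∈ Quadriphase.familyL f e m ρ lam β, Quadriphase.HasLeastPeriod s (2 ^ n - 1)) ∧
    ∃ Rmax : ℝ,
      IsGreatest (Quadriphase.correlationMagnitudes ω (2 ^ n - 1)
        (Quadriphase.familyL f e m ρ lam β)) Rmax ∧
      Rmax < 1 + (2 : ℝ) ^ (((n : ℝ) + 2 * ((ρ : ℝ) - 1) + 2 * (e : ℝ)) / 2) := by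
  subst hn
  have : Fact (Irreducible (f.map Quadriphase.red)) := ⟨hf.2.2.1⟩
  have : Module.Finite (ZMod 2) (Quadriphase.ResField f) :=
    (AdjoinRoot.powerBasis hf.2.2.1.ne_zero).finite
  have : Finite (Quadriphase.ResField f) := Module.finite_of_finite (ZMod 2)
  have : Fintype (Quadriphase.ResField f) := Fintype.ofFinite _
  obtain ⟨A, hA, hquad, halt⟩ := Quadriphase.exists_traceForms (by omega) hf hlam hlam1
  have hb := Quadriphase.mem_zpowers_map_proj hf hβ
  -- The general results apply with r = ρ - 1, the number of coefficients λ_k with k ≥ 1.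
  have hr : 2 * (ρ - 1) < e * m := by omega
  rw [Quadriphase.familyL_eq_range hf A hA hquad halt (hβ ▸ Subgroup.mem_zpowers β)]
  refine ⟨?_, A.cyclicallyDistinct_range_sequence hb hr, ?_, ?_⟩
  · rw [A.ncard_range_sequence hb hr, Nat.sub_add_cancel hρ]
  · rintro _ ⟨p, rfl⟩
    exact A.hasLeastPeriod_sequence hb hr p
  · have h := A.exists_isGreatest_correlationMagnitudes hb (by omega) hr hω
    rwa [Nat.cast_sub hρ, Nat.cast_one] at h
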